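/- **Setting.** Let $d\ge 1$, let $W\subset\mathbb R^d$ be compact with $o=0\in W$, and for a topological space $V$ let $\mathcal M(V)$ be the set of finite Borel measures on $V$ with the weak topology. Let $\mu\in\mathcal M(W)$ be absolutely continuous with respect to Lebesgue measure, with $\mu(W)>0$. Let $(N(\lambda))_{\lambda\ge 0}$ be a homogeneous Poisson process with intensity $\mu(W)$, let $X_1,X_2,\dots$ be i.i.d. with distribution $\mu/\mu(W)$, independent of $N$, and put $I^\lambda=\{1,\dots,N(\lambda)\}$, $X^\lambda=\{X_i: i\in I^\lambda\}$ and $L_\lambda=\frac1\lambda\sum_{i\in I^\lambda}\delta_{X_i}$. Let $k_{\max}\ge 1$ be an integer and write $[k_{\max}]=\{1,\dots,k_{\max}\}$. For $k\in[k_{\max}]$ let $f_k:\mathcal M(W)\times W^k\to\mathbb R$ be continuous and bounded from below, and put $\widetilde f_k(x_0,\dots,x_{k-1})=f_k(\mu,x_0,\dots,x_{k-1})$. A trajectory of user $i\in I^\lambda$ is $s^i=(s^i_{-1},s^i_0,\dots,s^i_{s^i_{-1}})$ with number of hops $s^i_{-1}\in[k_{\max}]$, $s^i_0=X_i$, relays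 $s^i_l\in X^\lambda$ for $1\le l\le s^i_{-1}-1$, and last point $o$. A configuration $s=(s^i)_{i\in I^\lambda}$ consists of one trajectory for each user. For $\gamma\ge 0$ let $$\mathrm P^{\gamma,0}_{\lambda,X^\lambda}(s)=\frac1{Z^{\gamma,0}_\lambda(X^\lambda)}\Big(\prod_{i\in I^\lambda}\frac1{N(\lambda)^{s^i_{-1}-1}}\Big)e^{-\gamma\mathfrak S(s)},\qquad \mathfrak S(s)=\sum_{i\in I^\lambda}f_{s^i_{-1}}(L_\lambda,s^i_0,\dots,s^i_{s^i_{-1}-1}),$$ where $Z^{\gamma,0}_\lambda(X^\lambda)$ normalizes this to a probability distribution on configurations. Let $\Sigma_\lambda(s)=(R_{\lambda,k}(s))_{k\in[k_{\max}]}$ with $R_{\lambda,k}(s)=\frac1\lambda\sum_{i\in I^\lambda:\,s^i_{-1}=k}\delta_{(s^i_0,\dots,s^i_{k-1})}$, an element of $\mathcal A_0=\prod_{k=1}^{k_{\max}}\mathcal M(W^k)$, which carries the product topology. Write $\pi_l\nu_k$ for the $l$-th marginal of $\nu_k\in\mathcal M(W^k)$, $l=0,\dots,k-1$. Call $\Sigma=(\nu_k)_k\in\mathcal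 A_0$ an asymptotic routeing strategy if $\sum_{k}\pi_0\nu_k=\mu$. Put $M=\sum_{k=1}^{k_{\max}}\sum_{l=1}^{k-1}\pi_l\nu_k$, $\mathrm S(\Sigma)=\sum_{k}\int_{W^k}\widetilde f_k\,\mathrm d\nu_k$ and $$\mathrm J(\Sigma)=\sum_{k=1}^{k_{\max}}\mathcal H_{W^k}(\nu_k\mid\mu^{\otimes k})-\sum_{k=2}^{k_{\max}}\mu(W)^k+M(W)\log\mu(W),$$ where $\mathcal H_V(\nu\mid\widetilde\nu)=\int_V\log\frac{\mathrm d\nu}{\mathrm d\widetilde\nu}\,\mathrm d\nu-\nu(V)+\widetilde\nu(V)$ if $\nu\ll\widetilde\nu$, and $+\infty$ otherwise. **Proposition.** Almost surely with respect to $(X^\lambda)_{\lambda>0}$ the following hold. 1. The distributions of $\Sigma_\lambda(S)$ under $\mathrm P^{0,0}_{\lambda,X^\lambda}$ satisfy a large deviation principle on $\mathcal A_0$ as $\lambda\to\infty$, with scale $\lambda$ and rate function $\Sigma\mapsto\mathrm J(\Sigma)+\mu(W)\log k_{\max}$, which is set equal to $\infty$ if $\Sigma$ is not an asymptotic routeing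 strategy. That is, the rate function $I$ is nonnegative and lower semicontinuous, $\limsup_{\lambda\to\infty}\frac1\lambda\log\mathrm P^{0,0}_{\lambda,X^\lambda}(\Sigma_\lambda(S)\in F)\le-\inf_F I$ for every closed $F\subseteq\mathcal A_0$, and $\liminf_{\lambda\to\infty}\frac1\lambda\log\mathrm P^{0,0}_{\lambda,X^\lambda}(\Sigma_\lambda(S)\in G)\ge-\inf_G I$ for every open $G\subseteq\mathcal A_0$. Moreover, $I$ has compact level sets. 2. For every $\gamma\in(0,\infty)$, $$\lim_{\lambda\to\infty}\frac1\lambda\log Z^{\gamma,0}_\lambda(X^\lambda)=-\inf_{\Sigma\text{ asymptotic routeing strategy}}\big(\mathrm J(\Sigma)+\gamma\,\mathrm S(\Sigma)\big).$$ 3. For every $\gamma\in(0,\infty)$, the infimum in 2. has a unique minimizer $\Sigma=(\nu_k)_{k\in[k_{\max}]}$, and it is given by $$\nu_k(\mathrm dx_0,\dots,\mathrm dx_{k-1})=\mu(\mathrm dx_0)\,A(x_0)\prod_{l=1}^{k-1}\frac{\mu(\mathrm dx_l)}{\mu(W)}\;e^{-\gamma\widetilde f_k(x_0,\dots,x_{k-1})},\qquad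 k\in[k_{\max}],$$ $$\frac1{A(x_0)}=\sum_{k=1}^{k_{\max}}\int_{W^{k-1}}\prod_{l=1}^{k-1}\frac{\mu(\mathrm dx_l)}{\mu(W)}\;e^{-\gamma\widetilde f_k(x_0,\dots,x_{k-1})},\qquad x_0\in W.$$ 4. For every $\gamma\in(0,\infty)$, the distribution of $\Sigma_\lambda(S)$ under $\mathrm P^{\gamma,0}_{\lambda,X^\lambda}$ converges to this minimizer $\Sigma$: for every neighbourhood $U$ of $\Sigma$, $\mathrm P^{\gamma,0}_{\lambda,X^\lambda}(\Sigma_\lambda(S)\notin U)\to0$ as $\lambda\to\infty$. -/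

import Mathlib

open MeasureTheory ProbabilityTheory Filter Topology
open scoped NNReal ENNReal

noncomputable section

namespace MultihopGibbs

/-! ### The users -/

/-- The data `(N(λ))_{λ ≥ 0}`, `(X_i)_{i ∈ ℕ}` that drive the user process: `N` is a homogeneous
Poisson process with intensity `μ(V)`, the locations `X_i` are i.i.d. with distribution
`μ / μ(V)`, and `N` and `(X_i)_i` are independent. The users at density `λ` are the points `X_i`
with `i < N(λ)`. -/
structure IsUserProcess {V : Type*} [MeasurableSpace V] {Ω : Type*} [MeasurableSpace Ω]
    (μ : FiniteMeasure V) (P : Measure Ω) (N : ℝ≥0 → Ω → ℕ) (X : ℕ → Ω → V) : Prop where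
  measurable_count : ∀ t, Measurable (N t)
  count_zero : ∀ᵐ ω ∂P, N 0 ω = 0
  count_paths : ∀ᵐ ω ∂P, Monotone (fun t => N t ω) ∧
    ∀ t, ContinuousWithinAt (fun r => N r ω) (Set.Ici t) t
  count_indep_increments : HasIndepIncrements N P
  count_increment_law : ∀ s t, s ≤ t →
    P.map (fun ω => N t ω - N s ω) = poissonMeasure (μ.mass * (t - s))
  measurable_location : ∀ i, Measurable (X i)
  location_law : ∀ i, P.map (X i) = ((μ : Measure V) Set.univ)⁻¹ • (μ : Measure V)
  location_indep : iIndepFun X P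
  count_indep_location : IndepFun (fun ω (t : ℝ≥0) => N t ω) (fun ω (i : ℕ) => X i ω) P

/-- The unit mass at `x`, as a finite measure. -/
def diracFM {V : Type*} [MeasurableSpace V] (x : V) : FiniteMeasure V :=
  (diracProba x).toFiniteMeasure

/-- The normalized empirical measure `L_λ = λ⁻¹ ∑_i δ_{x_i}` of the users `x_0, …, x_{n-1}`. -/
def userEmpirical {V : Type*} [MeasurableSpace V] (lam : ℝ≥0) {n : ℕ} (x : Fin n → V) :
    FiniteMeasure V :=
  lam⁻¹ • ∑ i, diracFM (x i)

/-! ### Message trajectories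

A number of hops in `{1, …, kmax}` is encoded as `k + 1` with `k : Fin kmax`; a trajectory with
`k + 1` hops has `k` relays. -/

/-- A message trajectory sent out by one of `n` users: the number of hops `k + 1` together with the
`k` relaying users. Its starting point is the location of the sender, its end point is the base
station `o`. -/
abbrev Trajectory (n kmax : ℕ) : Type := (k : Fin kmax) × (Fin k → Fin n)

/-- A collection of trajectories, one for each user. -/
abbrev TrajectoryConfig (n kmax : ℕ) : Type := Fin n → Trajectory n kmax

/-- The locations `(s_0, s_1, …, s_k)` visited before `o` by the message of user `i` if its relays
are the users `r_0, …, r_{k-1}`. -/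
def path {V : Type*} {n : ℕ} (x : Fin n → V) (i : Fin n) {k : ℕ} (r : Fin k → Fin n) :
    Fin (k + 1) → V :=
  Fin.cons (x i) (fun l => x (r l))

/-- The space `∏_{k = 1}^{kmax} 𝓜(V^k)`, with (where `V` has a topology) the product of the weak
topologies. -/
abbrev MeasureFamily (V : Type*) [MeasurableSpace V] (kmax : ℕ) : Type _ :=
  (k : Fin kmax) → FiniteMeasure (Fin ((k : ℕ) + 1) → V)

/-- The empirical measures `Σ_λ(s) = (R_{λ,k}(s))_k`: `R_{λ,k}(s)` is `λ⁻¹` times the sum of the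
point masses at the location vectors of those trajectories of `s` that have `k` hops. The pairs
`(i, r)` in the sum are the users `i` whose trajectory has that many hops, with its relays `r`. -/
def trajEmpirical {V : Type*} [MeasurableSpace V] (lam : ℝ≥0) {n kmax : ℕ} (x : Fin n → V)
    (s : TrajectoryConfig n kmax) : MeasureFamily V kmax :=
  fun k => lam⁻¹ •
    ∑ p : Fin n × (Fin k → Fin n) with s p.1 = ⟨k, p.2⟩, diracFM (path x p.1 p.2)

/-! ### The Gibbs distribution without congestion term -/

/-- The penalization functions `f_k : 𝓜(V) × V^k → ℝ`, for `k = 1, …, kmax`. -/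
abbrev Penalty (V : Type*) [MeasurableSpace V] (kmax : ℕ) : Type _ :=
  (k : Fin kmax) → FiniteMeasure V × (Fin ((k : ℕ) + 1) → V) → ℝ

/-- The energy `𝔖(s) = ∑_i f_k(L_λ, s^i_0, …, s^i_{k-1})`, with `k` the number of hops of `s^i`. -/
def energy {V : Type*} [MeasurableSpace V] {kmax : ℕ} (f : Penalty V kmax) (lam : ℝ≥0) {n : ℕ}
    (x : Fin n → V) (s : TrajectoryConfig n kmax) : ℝ :=
  ∑ i, f (s i).1 (userEmpirical lam x, path x i (s i).2)

/-- The unnormalized weight `(∏_i n^{-(k_i - 1)}) e^{-γ 𝔖(s)}`, with `k_i` the number of hops of the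
trajectory of user `i`. -/
def weight {V : Type*} [MeasurableSpace V] {kmax : ℕ} (f : Penalty V kmax) (γ : ℝ) (lam : ℝ≥0)
    {n : ℕ} (x : Fin n → V) (s : TrajectoryConfig n kmax) : ℝ :=
  (∏ i, 1 / (n : ℝ) ^ ((s i).1 : ℕ)) * Real.exp (-γ * energy f lam x s)

/-- The partition function `Z_λ^{γ,0}`. -/
def partitionFunction {V : Type*} [MeasurableSpace V] {kmax : ℕ} (f : Penalty V kmax) (γ : ℝ)
    (lam : ℝ≥0) {n : ℕ} (x : Fin n → V) : ℝ :=
  ∑ s : TrajectoryConfig n kmax, weight f γ lam x s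

/-- The probability of `Σ_λ(S) ∈ E` under the Gibbs distribution `P_λ^{γ,0}`. -/
def gibbsProb {V : Type*} [MeasurableSpace V] {kmax : ℕ} (f : Penalty V kmax) (γ : ℝ)
    (lam : ℝ≥0) {n : ℕ} (x : Fin n → V) (E : Set (MeasureFamily V kmax)) : ℝ :=
  ∑ s : TrajectoryConfig n kmax,
    {s | trajEmpirical lam x s ∈ E}.indicator
      (fun s => weight f γ lam x s / partitionFunction f γ lam x) s

/-! ### The variational problem -/

/-- `Σ = (ν_k)_k` is an asymptotic routeing strategy: `∑_k π_0 ν_k = μ`. -/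
def IsRouteingStrategy {V : Type*} [MeasurableSpace V] {kmax : ℕ} (μ : FiniteMeasure V)
    (S : MeasureFamily V kmax) : Prop :=
  ∑ k, (S k).map (fun y => y 0) = μ

/-- The measure `M = ∑_k ∑_{l = 1}^{k - 1} π_l ν_k`. -/
def relayMeasure {V : Type*} [MeasurableSpace V] {kmax : ℕ} (S : MeasureFamily V kmax) :
    FiniteMeasure V :=
  ∑ k : Fin kmax, ∑ l : Fin k, (S k).map (fun y => y l.succ)

/-- The entropy term
`J(Σ) = ∑_{k=1}^{kmax} H(ν_k | μ^{⊗k}) - ∑_{k=2}^{kmax} μ(V)^k + M(V) log μ(V)`.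
Here `InformationTheory.klDiv ν ν'` is `∫ log(dν/dν') dν - ν(V) + ν'(V)`, and `∞` if there is no
density. -/
def entropyJ {V : Type*} [MeasurableSpace V] {kmax : ℕ} (μ : FiniteMeasure V)
    (S : MeasureFamily V kmax) : EReal :=
  ((∑ k : Fin kmax, InformationTheory.klDiv (S k : Measure (Fin ((k : ℕ) + 1) → V))
      (Measure.pi fun _ => (μ : Measure V)) : ℝ≥0∞) : EReal)
    - ((∑ k ∈ Finset.Icc 2 kmax, (μ.mass : ℝ) ^ k : ℝ) : EReal)
    + (((relayMeasure S).mass * Real.log μ.mass : ℝ) : EReal)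

/-- The limiting penalization `S(Σ) = ∑_k ∫ f_k(μ, ·) dν_k`. -/
def limitPenalty {V : Type*} [MeasurableSpace V] {kmax : ℕ} (f : Penalty V kmax)
    (μ : FiniteMeasure V) (S : MeasureFamily V kmax) : ℝ :=
  ∑ k : Fin kmax, ∫ y, f k (μ, y) ∂(S k : Measure (Fin ((k : ℕ) + 1) → V))

/-- The functional `J(Σ) + γ S(Σ)`. -/
def freeEnergy {V : Type*} [MeasurableSpace V] {kmax : ℕ} (f : Penalty V kmax) (γ : ℝ)
    (μ : FiniteMeasure V) (S : MeasureFamily V kmax) : EReal :=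
  entropyJ μ S + ((γ * limitPenalty f μ S : ℝ) : EReal)

/-- `Σ` minimizes `J + γ S` over all asymptotic routeing strategies. -/
def IsMinimizer {V : Type*} [MeasurableSpace V] {kmax : ℕ} (f : Penalty V kmax) (γ : ℝ)
    (μ : FiniteMeasure V) (S : MeasureFamily V kmax) : Prop :=
  IsRouteingStrategy μ S ∧
    ∀ S' : MeasureFamily V kmax, IsRouteingStrategy μ S' → freeEnergy f γ μ S ≤ freeEnergy f γ μ S'

open Classical in
/-- The rate function: `J(Σ) + μ(V) log kmax` if `Σ` is an asymptotic routeing strategy, and `∞`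
otherwise. -/
def rateFunction {V : Type*} [MeasurableSpace V] {kmax : ℕ} (μ : FiniteMeasure V)
    (S : MeasureFamily V kmax) : EReal :=
  if IsRouteingStrategy μ S then entropyJ μ S + ((μ.mass * Real.log kmax : ℝ) : EReal) else ⊤

/-- The normalizing function `A`, given by
`1 / A(x_0) = ∑_k ∫_{V^{k-1}} ∏_{l=1}^{k-1} μ(dx_l)/μ(V) e^{-γ f_k(μ, x_0, …, x_{k-1})}`. -/
def normalizerA {V : Type*} [MeasurableSpace V] {kmax : ℕ} (f : Penalty V kmax) (γ : ℝ)
    (μ : FiniteMeasure V) (x₀ : V) : ℝ :=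
  (∑ k : Fin kmax, ((μ.mass : ℝ) ^ (k : ℕ))⁻¹ *
    ∫ y : Fin (k : ℕ) → V, Real.exp (-γ * f k (μ, Fin.cons x₀ y))
      ∂(Measure.pi fun _ => (μ : Measure V)))⁻¹

/-- The measure
`μ(dx_0) A(x_0) ∏_{l=1}^{k-1} μ(dx_l)/μ(V) e^{-γ f_k(μ, x_0, …, x_{k-1})}` on `V^k`. -/
def explicitMeasure {V : Type*} [MeasurableSpace V] {kmax : ℕ} (f : Penalty V kmax) (γ : ℝ)
    (μ : FiniteMeasure V) (k : Fin kmax) : Measure (Fin ((k : ℕ) + 1) → V) :=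
  (Measure.pi fun _ => (μ : Measure V)).withDensity fun y => ENNReal.ofReal
    (normalizerA f γ μ (y 0) * ((μ.mass : ℝ) ^ (k : ℕ))⁻¹ * Real.exp (-γ * f k (μ, y)))

/-! ### Large deviation principles -/

/-- The large deviation principle with scale `λ` as `λ → ∞` for the distributions `Q λ` on `Y` with
rate function `I`: `I` is nonnegative and lower semicontinuous,
`limsup λ⁻¹ log Q_λ(F) ≤ - inf_F I` for closed `F` and `liminf λ⁻¹ log Q_λ(G) ≥ - inf_G I` for open
`G`, with `log 0 = -∞`. -/
structure IsLDP {Y : Type*} [TopologicalSpace Y] (Q : ℝ≥0 → Set Y → ℝ) (I : Y → EReal) : Prop where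
  nonneg : ∀ y, 0 ≤ I y
  lowerSemicontinuous : LowerSemicontinuous I
  upper : ∀ F : Set Y, IsClosed F →
    limsup (fun lam : ℝ≥0 => (((lam : ℝ)⁻¹ : ℝ) : EReal) * ENNReal.log (ENNReal.ofReal (Q lam F)))
      atTop ≤ -(⨅ y ∈ F, I y)
  lower : ∀ G : Set Y, IsOpen G → -(⨅ y ∈ G, I y) ≤
    liminf (fun lam : ℝ≥0 => (((lam : ℝ)⁻¹ : ℝ) : EReal) * ENNReal.log (ENNReal.ofReal (Q lam G)))
      atTop

end MultihopGibbs

end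

noncomputable section

set_option linter.unusedSectionVars false

namespace MultihopGibbs

/-! ### Convex duality for the relative entropy of finite measures -/

section Duality

open InformationTheory

variable {Y : Type*} [MeasurableSpace Y]

/-! Without a congestion term the users choose their trajectories independently given the locations.
The weight of a configuration is a product over users, and the relay factors `n^{-(k-1)}` turn the
sums over relays into integrals against powers of the normalized empirical measure `L_λ`. Hence the
partition function is exactly `exp(λ · pressure g L_λ)` (`partitionFunction_eq_exp_pressure`), where
`pressure` is weakly continuous at `μ` (`tendsto_pressure`). The only probabilistic input is that
`L_λ → μ` almost surely (`IsUserProcess.tendsto_userEmpirical`), by the law of large numbers.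
Everything after that is deterministic and holds for an arbitrary continuous penalty `g`; the claims
are the cases `g = 0 · f` and `g = γ f`.

On the variational side, `J + S + pressure` restricted to routeing strategies is a sum of relative
entropies with respect to one explicit family, `optimal g μ` (`klSum_eq_freeEnergy`). This gives the
unique minimizer and the value of the infimum. The identity comes from the dual formula `H(ν | ρ) =
sup_φ (∫ φ dν - ∫ (e^φ - 1) dρ)` over continuous `φ`, in which a change of density by `e^ψ` is a
translation of test functions (`klDiv_withDensity_exp`).

The large deviations follow the Gärtner–Ellis pattern. Tilting a Gibbs measure by `e^{λ⟨φ, Σ_λ⟩}`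
replaces `g` by `g - φ` (`weight_tilt`), so the limiting log-moment generating function is a
difference of pressures, and `gibbsRate` is its Legendre transform (`exists_lt_legendre`,
`legendre_le_gibbsRate`). Chebyshev's inequality gives the upper bound near each point. Families of
bounded mass form a compact set that eventually contains every realized `Σ_λ`, which extends the
bound to closed sets and yields concentration at `optimal g μ`, the only zero of the rate. For the
lower bound, the measure tilted by `φ` concentrates at `optimal (tilt g φ) μ`, and undoing the tilt
costs the entropy of that point. Such points approximate every strategy of finite entropy without
exceeding its entropy (`exists_tilt_mem_open`). -/

/-- The functional `∫ φ dν - ∫ (e^φ - 1) dρ`, whose supremum over `φ` is the relative entropy. -/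
def entropyGap (ν ρ : Measure Y) (φ : Y → ℝ) : ℝ :=
  ∫ y, φ y ∂ν - ∫ y, (Real.exp (φ y) - 1) ∂ρ

lemma integrable_of_abs_le {ν : Measure Y} [IsFiniteMeasure ν] {φ : Y → ℝ} (hφ : Measurable φ)
    {M : ℝ} (hM : ∀ y, |φ y| ≤ M) : Integrable φ ν :=
  Integrable.of_bound hφ.aestronglyMeasurable M (ae_of_all _ fun y => by simpa using hM y)

lemma integrable_exp_of_abs_le {ν : Measure Y} [IsFiniteMeasure ν] {φ : Y → ℝ}
    (hφ : Measurable φ) {M : ℝ} (hM : ∀ y, |φ y| ≤ M) :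
    Integrable (fun y => Real.exp (φ y)) ν :=
  integrable_of_abs_le (M := Real.exp M) (by fun_prop) fun y => by
    rw [abs_of_pos (Real.exp_pos _)]
    exact Real.exp_le_exp.2 ((le_abs_self _).trans (hM y))

lemma integrable_exp_sub_one_of_abs_le {ν : Measure Y} [IsFiniteMeasure ν] {φ : Y → ℝ}
    (hφ : Measurable φ) {M : ℝ} (hM : ∀ y, |φ y| ≤ M) :
    Integrable (fun y => Real.exp (φ y) - 1) ν :=
  (integrable_exp_of_abs_le hφ hM).sub (integrable_const 1)

lemma integrable_mul_of_abs_le {ν : Measure Y} [IsFiniteMeasure ν] {φ g : Y → ℝ}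
    (hφ : Measurable φ) (hg : Integrable g ν) {M : ℝ} (hM : ∀ y, |φ y| ≤ M) :
    Integrable (fun y => g y * φ y) ν :=
  hg.mul_bdd hφ.aestronglyMeasurable (ae_of_all _ fun y => by simpa using hM y)

lemma entropyGap_eq_integral {ν ρ : Measure Y} [IsFiniteMeasure ν] [IsFiniteMeasure ρ]
    (hac : ν ≪ ρ) {φ : Y → ℝ} (hφ : Measurable φ) {M : ℝ} (hM : ∀ y, |φ y| ≤ M) :
    entropyGap ν ρ φ =
      ∫ y, ((ν.rnDeriv ρ y).toReal * φ y - (Real.exp (φ y) - 1)) ∂ρ := by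
  rw [integral_sub (integrable_mul_of_abs_le hφ Measure.integrable_toReal_rnDeriv hM)
    (integrable_exp_sub_one_of_abs_le hφ hM), entropyGap]
  congr 1
  exact (integral_rnDeriv_smul (f := φ) hac).symm

/-- Fenchel–Young inequality: `e^t - 1` is the convex conjugate of `klFun`. For `g > 0` it is `1 + s
≤ e^s` at `s = t - log g`. -/
lemma mul_sub_exp_le_klFun {g : ℝ} (hg : 0 ≤ g) (t : ℝ) :
    g * t - (Real.exp t - 1) ≤ klFun g := by
  rw [klFun_apply]
  rcases hg.eq_or_lt with rfl | hg
  · simp; positivity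
  · have h := Real.add_one_le_exp (t - Real.log g)
    rw [Real.exp_sub, Real.exp_log hg, le_div_iff₀ hg] at h
    linarith

lemma entropyGap_le_klDiv {ν ρ : Measure Y} [IsFiniteMeasure ν] [IsFiniteMeasure ρ]
    {φ : Y → ℝ} (hφ : Measurable φ) {M : ℝ} (hM : ∀ y, |φ y| ≤ M) :
    (entropyGap ν ρ φ : EReal) ≤ (klDiv ν ρ : EReal) := by
  by_cases htop : klDiv ν ρ = ∞
  · simp [htop]
  obtain ⟨hac, hint⟩ := klDiv_ne_top_iff.1 htop
  rw [← ENNReal.ofReal_toReal htop, EReal.coe_ennreal_ofReal, max_eq_left ENNReal.toReal_nonneg,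
    EReal.coe_le_coe_iff, toReal_klDiv_eq_integral_klFun hac, entropyGap_eq_integral hac hφ hM]
  refine integral_mono ?_ ((integrable_klFun_rnDeriv_iff hac).2 hint) fun y =>
    mul_sub_exp_le_klFun ENNReal.toReal_nonneg _
  exact (integrable_mul_of_abs_le hφ Measure.integrable_toReal_rnDeriv hM).sub
    (integrable_exp_sub_one_of_abs_le hφ hM)

/-- The truncation of `g` to `[1 / (n + 1), n + 1]`. -/
def truncate (n : ℕ) (g : ℝ) : ℝ := max (1 / ((n : ℝ) + 1)) (min g (n + 1))

lemma truncate_lower (n : ℕ) (g : ℝ) : 1 / ((n : ℝ) + 1) ≤ truncate n g := le_max_left _ _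

lemma truncate_upper (n : ℕ) (g : ℝ) : truncate n g ≤ n + 1 := by
  refine max_le ?_ (min_le_right _ _)
  have : (0 : ℝ) ≤ n := n.cast_nonneg
  rw [div_le_iff₀ (by positivity)]
  nlinarith

lemma truncate_pos (n : ℕ) (g : ℝ) : 0 < truncate n g :=
  lt_of_lt_of_le (by positivity) (truncate_lower n g)

lemma abs_log_truncate_le (n : ℕ) (g : ℝ) : |Real.log (truncate n g)| ≤ Real.log (n + 1) := by
  rw [abs_le]
  constructor
  · rw [← Real.log_inv, ← one_div]
    exact Real.log_le_log (by positivity) (truncate_lower n g)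
  · exact Real.log_le_log (truncate_pos n g) (truncate_upper n g)

/-- With `b` the truncated value, `b log b ≥ b - 1`, and `g - b` has the sign of `log b` because
truncation moves `g` towards `1`. This nonnegativity is what permits Fatou's lemma in the dual
formula. -/
lemma mul_log_truncate_nonneg (n : ℕ) (g : ℝ) :
    0 ≤ g * Real.log (truncate n g) - (truncate n g - 1) := by
  set b := truncate n g with hb
  have hpos : 0 < b := truncate_pos n g
  have h1 : b - 1 ≤ b * Real.log b := by
    have := Real.one_sub_inv_le_log_of_pos hpos
    calc b - 1 = b * (1 - b⁻¹) := by field_simp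
      _ ≤ _ := by gcongr
  have h2 : 0 ≤ (g - b) * Real.log b := by
    have hn : (0 : ℝ) ≤ n := n.cast_nonneg
    rcases le_total g 1 with hg | hg
    · have hb1 : b ≤ 1 := by
        refine max_le ?_ ((min_le_left _ _).trans hg)
        rw [div_le_iff₀ (by positivity)]; linarith
      have hgb : g ≤ b := by
        refine le_max_of_le_right (le_min le_rfl (by linarith))
      exact mul_nonneg_of_nonpos_of_nonpos (by linarith) (Real.log_nonpos hpos.le hb1)
    · have hb1 : 1 ≤ b := le_max_of_le_right (le_min hg (by linarith))
      have hgb : b ≤ g := by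
        refine max_le ?_ (min_le_left _ _)
        refine le_trans ?_ hg
        rw [div_le_iff₀ (by positivity)]; linarith
      exact mul_nonneg (by linarith) (Real.log_nonneg hb1)
  nlinarith

lemma tendsto_mul_log_truncate {g : ℝ} (hg : 0 ≤ g) :
    Tendsto (fun n : ℕ => g * Real.log (truncate n g) - (truncate n g - 1)) atTop
      (𝓝 (klFun g)) := by
  rcases hg.eq_or_lt with rfl | hg
  · have : ∀ n : ℕ, truncate n 0 = 1 / ((n : ℝ) + 1) := fun n => by
      rw [truncate, min_eq_left (by positivity), max_eq_left (by positivity)]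
    simp only [this, zero_mul, zero_sub, klFun_zero]
    simpa using (tendsto_one_div_add_atTop_nhds_zero_nat (𝕜 := ℝ)).const_sub 1
  · refine tendsto_const_nhds.congr' ?_
    have h1 : ∀ᶠ n : ℕ in atTop, 1 / ((n : ℝ) + 1) < g :=
      (tendsto_one_div_add_atTop_nhds_zero_nat (𝕜 := ℝ)).eventually_lt_const hg
    have h2 : ∀ᶠ n : ℕ in atTop, g ≤ n := tendsto_natCast_atTop_atTop.eventually_ge_atTop g
    filter_upwards [h1, h2] with n h1 h2
    have : truncate n g = g := by
      rw [truncate, min_eq_left (by linarith), max_eq_right h1.le]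
    rw [this, klFun_apply]; ring

/-- The optimal test function is the logarithm of the density. It may be unbounded, so it is
truncated, and Fatou's lemma shows that the gaps of the truncations do not stay below the entropy.
Without absolute continuity, a large multiple of the indicator of a `ρ`-null set does the job. -/
lemma exists_measurable_lt_entropyGap {ν ρ : Measure Y} [IsFiniteMeasure ν] [IsFiniteMeasure ρ]
    {a : ℝ} (ha : (a : EReal) < (klDiv ν ρ : EReal)) :
    ∃ φ : Y → ℝ, Measurable φ ∧ (∃ M, ∀ y, |φ y| ≤ M) ∧ a < entropyGap ν ρ φ := by
  rcases lt_or_ge a 0 with ha0 | ha0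
  · exact ⟨0, measurable_zero, ⟨0, by simp⟩, by simpa [entropyGap] using ha0⟩
  by_cases hac : ν ≪ ρ
  · have hlt : ENNReal.ofReal a < klDiv ν ρ := by
      rw [← EReal.coe_ennreal_lt_coe_ennreal_iff, EReal.coe_ennreal_ofReal, max_eq_left ha0]
      exact ha
    set g : Y → ℝ := fun y => (ν.rnDeriv ρ y).toReal with hg
    have hgm : Measurable g := by fun_prop
    let φ : ℕ → Y → ℝ := fun n y => Real.log (truncate n (g y))
    have hφm : ∀ n, Measurable (φ n) := fun n => by
      unfold φ truncate; fun_prop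
    have hφM : ∀ n y, |φ n y| ≤ Real.log (n + 1) := fun n y => abs_log_truncate_le n _
    have hgap : ∀ n, ENNReal.ofReal (entropyGap ν ρ (φ n)) =
        ∫⁻ y, ENNReal.ofReal (g y * Real.log (truncate n (g y)) - (truncate n (g y) - 1)) ∂ρ := by
      intro n
      rw [entropyGap_eq_integral hac (hφm n) (hφM n), ofReal_integral_eq_lintegral_ofReal]
      · refine lintegral_congr fun y => ?_
        simp only [φ, Real.exp_log (truncate_pos _ _), g]
      · exact (integrable_mul_of_abs_le (hφm n) Measure.integrable_toReal_rnDeriv (hφM n)).sub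
          (integrable_exp_sub_one_of_abs_le (hφm n) (hφM n))
      · refine ae_of_all _ fun y => ?_
        simpa only [φ, Pi.zero_apply, Real.exp_log (truncate_pos _ _)] using
          mul_log_truncate_nonneg n (g y)
    have hle : klDiv ν ρ ≤ liminf (fun n => ENNReal.ofReal (entropyGap ν ρ (φ n))) atTop := by
      rw [klDiv_eq_lintegral_klFun_of_ac hac]
      simp_rw [hgap]
      refine le_trans (le_of_eq (lintegral_congr fun y => ?_)) (lintegral_liminf_le fun n => ?_)
      · exact (((ENNReal.continuous_ofReal.tendsto _).comp
          (tendsto_mul_log_truncate ENNReal.toReal_nonneg)).liminf_eq).symm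
      · unfold truncate; fun_prop
    obtain ⟨m, hm⟩ := (eventually_lt_of_lt_liminf (hlt.trans_le hle)).exists
    refine ⟨φ m, hφm m, ⟨_, hφM m⟩, ?_⟩
    by_contra hcon
    exact absurd hm (not_lt.2 (ENNReal.ofReal_le_ofReal (not_lt.1 hcon)))
  · obtain ⟨A, hA, hρ, hν⟩ : ∃ A, MeasurableSet A ∧ ρ A = 0 ∧ ν A ≠ 0 := by
      by_contra! h
      exact hac (Measure.AbsolutelyContinuous.mk fun s hs h0 => h s hs h0)
    have hνpos : 0 < ν.real A := ENNReal.toReal_pos hν (measure_ne_top _ _)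
    -- The height makes the gap exactly `a + 1`: the exponential term does not see the `ρ`-null set
    -- `A`.
    set t : ℝ := (a + 1) / ν.real A with ht
    refine ⟨A.indicator fun _ => t, measurable_const.indicator hA, ⟨|t|, fun y => ?_⟩, ?_⟩
    · by_cases hy : y ∈ A <;> simp [hy]
    · have hz : ∫ y, (Real.exp (A.indicator (fun _ => t) y) - 1) ∂ρ = 0 := by
        refine integral_eq_zero_of_ae ?_
        filter_upwards [measure_eq_zero_iff_ae_notMem.1 hρ] with y hy
        simp [hy]
      rw [entropyGap, hz, integral_indicator_const _ hA, sub_zero, smul_eq_mul, ht]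
      rw [mul_div_cancel₀ _ hνpos.ne']
      linarith

/-! ### Continuous test functions on compact spaces. -/

variable [TopologicalSpace Y] [BorelSpace Y] [CompactSpace Y]

lemma exists_abs_le_of_continuous {Z : Type*} [TopologicalSpace Z] [CompactSpace Z]
    {φ : Z → ℝ} (hφ : Continuous φ) : ∃ M, ∀ y, |φ y| ≤ M := by
  obtain ⟨M, hM⟩ := isCompact_univ.exists_bound_of_continuousOn hφ.continuousOn
  exact ⟨M, fun y => by simpa using hM y (Set.mem_univ y)⟩

lemma abs_exp_sub_exp_le {M a b : ℝ} (ha : a ≤ M) (hb : b ≤ M) :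
    |Real.exp a - Real.exp b| ≤ Real.exp M * |a - b| := by
  wlog h : b ≤ a generalizing a b
  · rw [abs_sub_comm, abs_sub_comm a b]
    exact this hb ha (le_of_not_ge h)
  rw [abs_of_nonneg (sub_nonneg.2 (Real.exp_le_exp.2 h)), abs_of_nonneg (sub_nonneg.2 h)]
  have h1 := Real.add_one_le_exp (b - a)
  rw [Real.exp_sub, le_div_iff₀ (Real.exp_pos a)] at h1
  have h2 : Real.exp a * (a - b) ≤ Real.exp M * (a - b) := by
    have := sub_nonneg.2 h
    gcongr
  nlinarith

lemma integrable_of_continuous {ν : Measure Y} [IsFiniteMeasure ν] {φ : Y → ℝ}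
    (hφ : Continuous φ) : Integrable φ ν := by
  obtain ⟨M, hM⟩ := exists_abs_le_of_continuous hφ
  exact integrable_of_abs_le hφ.measurable hM

lemma entropyGap_le_klDiv_of_continuous {ν ρ : Measure Y} [IsFiniteMeasure ν] [IsFiniteMeasure ρ]
    {φ : Y → ℝ} (hφ : Continuous φ) : (entropyGap ν ρ φ : EReal) ≤ (klDiv ν ρ : EReal) := by
  obtain ⟨M, hM⟩ := exists_abs_le_of_continuous hφ
  exact entropyGap_le_klDiv hφ.measurable hM

variable [TopologicalSpace.PseudoMetrizableSpace Y]

lemma exists_continuous_lt_entropyGap {ν ρ : Measure Y} [IsFiniteMeasure ν] [IsFiniteMeasure ρ]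
    {a : ℝ} (ha : (a : EReal) < (klDiv ν ρ : EReal)) :
    ∃ φ : Y → ℝ, Continuous φ ∧ a < entropyGap ν ρ φ := by
  obtain ⟨φ, hφ, ⟨M, hM⟩, hgap⟩ := exists_measurable_lt_entropyGap ha
  set ε := (entropyGap ν ρ φ - a) / 2 with hε
  have hεpos : 0 < ε := by rw [hε]; linarith
  -- One approximation in `L¹(ν + ρ)` controls both terms of the gap. The exponential is Lipschitz
  -- with constant `e^M` on `[-M, M]`, hence the divisor `1 + e^M` and the clipping in `ψ` below.
  obtain ⟨g, hg, -⟩ := (integrable_of_abs_le (ν := ν + ρ) hφ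
    hM).exists_boundedContinuous_integral_sub_le
    (ε := ε / (1 + Real.exp M)) (by positivity)
  let ψ : Y → ℝ := fun y => max (-M) (min (g y) M)
  have hψc : Continuous ψ := by unfold ψ; fun_prop
  have hM0 : ∀ y : Y, -M ≤ M := fun y => by linarith [(abs_le.1 (hM y)).1, (abs_le.1 (hM y)).2]
  have hψM : ∀ y, |ψ y| ≤ M := fun y =>
    abs_le.2 ⟨le_max_left _ _, max_le (hM0 y) (min_le_right _ _)⟩
  have hdist : ∀ y, |φ y - ψ y| ≤ ‖φ y - g y‖ := fun y => by
    rw [Real.norm_eq_abs]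
    have h1 := abs_le.1 (hM y)
    have : φ y = max (-M) (min (φ y) M) := by rw [min_eq_left h1.2, max_eq_right h1.1]
    calc |φ y - ψ y| = |max (-M) (min (φ y) M) - max (-M) (min (g y) M)| := by rw [← this]
      _ ≤ |min (φ y) M - min (g y) M| := by
        simpa using abs_max_sub_max_le_max (-M) (min (φ y) M) (-M) (min (g y) M)
      _ ≤ |φ y - g y| := by
        simpa using abs_min_sub_min_le_max (φ y) M (g y) M
  refine ⟨ψ, hψc, ?_⟩
  have hint : ∀ (m : Measure Y) [IsFiniteMeasure m], Integrable (fun y => |φ y - ψ y|) m :=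
    fun m _ => ((integrable_of_abs_le hφ hM).sub (integrable_of_abs_le hψc.measurable hψM)).abs
  have hgi : ∀ (m : Measure Y) [IsFiniteMeasure m], Integrable (fun y => ‖φ y - g y‖) m :=
    fun m _ => ((integrable_of_abs_le hφ hM).sub (g.integrable m)).norm
  have hA : ∫ y, |φ y - ψ y| ∂ν + ∫ y, |φ y - ψ y| ∂ρ ≤ ε / (1 + Real.exp M) := by
    rw [← integral_add_measure (hint ν) (hint ρ)]
    exact (integral_mono (hint _) (hgi _) hdist).trans hg
  have h1 : ∫ y, φ y ∂ν - ∫ y, ψ y ∂ν ≤ ∫ y, |φ y - ψ y| ∂ν := by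
    rw [← integral_sub (integrable_of_abs_le hφ hM) (integrable_of_abs_le hψc.measurable hψM)]
    exact (le_abs_self _).trans (abs_integral_le_integral_abs)
  have h2 : ∫ y, (Real.exp (ψ y) - 1) ∂ρ - ∫ y, (Real.exp (φ y) - 1) ∂ρ ≤
      Real.exp M * ∫ y, |φ y - ψ y| ∂ρ := by
    rw [← integral_sub (integrable_exp_sub_one_of_abs_le hψc.measurable hψM)
      (integrable_exp_sub_one_of_abs_le hφ hM), ← integral_const_mul]
    refine integral_mono ((integrable_exp_sub_one_of_abs_le hψc.measurable hψM).sub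
      (integrable_exp_sub_one_of_abs_le hφ hM)) ((hint ρ).const_mul _) fun y => ?_
    have := abs_exp_sub_exp_le ((abs_le.1 (hψM y)).2) ((abs_le.1 (hM y)).2)
    rw [abs_sub_comm (ψ y)] at this
    have := (le_abs_self _).trans this
    dsimp only
    linarith
  have hν0 : 0 ≤ ∫ y, |φ y - ψ y| ∂ν := integral_nonneg fun _ => abs_nonneg _
  have hρ0 : 0 ≤ ∫ y, |φ y - ψ y| ∂ρ := integral_nonneg fun _ => abs_nonneg _
  have hE := Real.exp_pos M
  rw [le_div_iff₀ (by positivity)] at hA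
  have : entropyGap ν ρ φ - entropyGap ν ρ ψ ≤ ε := by
    unfold entropyGap
    nlinarith
  linarith

/-- Replacing the reference measure `ρ` by `e^ψ ρ` shifts the relative entropy by a constant and a
linear functional. -/
lemma klDiv_withDensity_exp {ν ρ : Measure Y} [IsFiniteMeasure ν] [IsFiniteMeasure ρ] {ψ : Y → ℝ}
    (hψ : Continuous ψ) :
    (klDiv ν (ρ.withDensity fun y => ENNReal.ofReal (Real.exp (ψ y))) : EReal) =
      (klDiv ν ρ : EReal) + ((∫ y, (Real.exp (ψ y) - 1) ∂ρ - ∫ y, ψ y ∂ν : ℝ) : EReal) := by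
  set ρ' := ρ.withDensity fun y => ENNReal.ofReal (Real.exp (ψ y)) with hρ'
  obtain ⟨M, hM⟩ := exists_abs_le_of_continuous hψ
  have : IsFiniteMeasure ρ' := isFiniteMeasure_withDensity_ofReal
    (integrable_exp_of_abs_le hψ.measurable hM).2
  -- Changing the reference measure translates the test function by `ψ` and adds a constant.
  -- Translation by `ψ` is a bijection of the continuous functions, so the two suprema differ by
  -- that constant, even when they are infinite.
  have hgap : ∀ φ : Y → ℝ, Continuous φ → entropyGap ν ρ' φ =
      entropyGap ν ρ (fun y => φ y + ψ y) + (∫ y, (Real.exp (ψ y) - 1) ∂ρ - ∫ y, ψ y ∂ν) := by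
    intro φ hφ
    have : ∫ y, (Real.exp (φ y) - 1) ∂ρ' = ∫ y, (Real.exp (φ y + ψ y) - 1) ∂ρ
        - ∫ y, (Real.exp (ψ y) - 1) ∂ρ := by
      rw [hρ', integral_withDensity_eq_integral_toReal_smul (by fun_prop) (by simp),
        ← integral_sub (integrable_of_continuous (by fun_prop))
          (integrable_of_continuous (by fun_prop))]
      refine integral_congr_ae (ae_of_all _ fun y => ?_)
      simp only [ENNReal.toReal_ofReal (Real.exp_pos _).le, smul_eq_mul, Real.exp_add]
      ring
    rw [entropyGap, this, entropyGap, integral_add (integrable_of_continuous hφ)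
      (integrable_of_continuous hψ)]
    ring
  set c : ℝ := ∫ y, (Real.exp (ψ y) - 1) ∂ρ - ∫ y, ψ y ∂ν with hc
  apply le_antisymm
  · refine EReal.le_of_forall_lt_iff_le.1 fun a ha => ?_
    by_contra hcon
    obtain ⟨φ, hφ, hlt⟩ := exists_continuous_lt_entropyGap (not_le.1 hcon)
    rw [hgap φ hφ] at hlt
    have h1 : ((entropyGap ν ρ (fun y => φ y + ψ y) + c : ℝ) : EReal) ≤
        (klDiv ν ρ : EReal) + (c : EReal) := by
      rw [EReal.coe_add]
      exact add_le_add_left (entropyGap_le_klDiv_of_continuous (hφ.add hψ)) _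
    exact absurd (ha.trans_le' (h1.trans' (EReal.coe_le_coe_iff.2 hlt.le))) (lt_irrefl _)
  · have key : (klDiv ν ρ : EReal) ≤ (klDiv ν ρ' : EReal) - (c : EReal) := by
      refine EReal.le_of_forall_lt_iff_le.1 fun a ha => ?_
      by_contra hcon
      obtain ⟨φ, hφ, hlt⟩ := exists_continuous_lt_entropyGap (not_le.1 hcon)
      have h2 := hgap (fun y => φ y - ψ y) (hφ.sub hψ)
      simp only [sub_add_cancel] at h2
      have h3 := entropyGap_le_klDiv_of_continuous (ν := ν) (ρ := ρ')
        (φ := fun y => φ y - ψ y) (hφ.sub hψ)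
      rw [h2, EReal.coe_add] at h3
      have h4 : (entropyGap ν ρ φ : EReal) ≤ (klDiv ν ρ' : EReal) - (c : EReal) :=
        EReal.le_sub_iff_add_le (by simp) (by simp) |>.2 h3
      exact absurd (ha.trans_le' (h4.trans' (EReal.coe_le_coe_iff.2 hlt.le))) (lt_irrefl _)
    exact (EReal.le_sub_iff_add_le (by simp) (by simp)).1 key

end Duality

/-! ### Joint continuity of integrals in the measure and the integrand -/

section Continuity

/-- Compactness of `Y` makes `x ↦ g x ·` continuous in the sup norm. The integral then splits into a
fixed integrand, handled by weak continuity, and an error of at most sup norm times mass. -/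
lemma continuous_integral_finiteMeasure {X Y : Type*} [TopologicalSpace X] [TopologicalSpace Y]
    [MeasurableSpace Y] [BorelSpace Y] [CompactSpace Y] {L : X → FiniteMeasure Y}
    (hL : Continuous L) {g : X → Y → ℝ} (hg : Continuous (Function.uncurry g)) :
    Continuous fun x => ∫ y, g x y ∂(L x : Measure Y) := by
  let C : C(X, C(Y, ℝ)) := ContinuousMap.curry ⟨Function.uncurry g, hg⟩
  have hC : ∀ x y, C x y = g x y := fun x y => rfl
  rw [continuous_iff_continuousAt]
  intro x₀
  have h1 : Tendsto (fun x => ∫ y, C x₀ y ∂(L x : Measure Y)) (𝓝 x₀)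
      (𝓝 (∫ y, C x₀ y ∂(L x₀ : Measure Y))) :=
    ((FiniteMeasure.continuous_integral_continuousMap (C x₀)).comp hL).tendsto x₀
  have h2 : Tendsto (fun x => ‖C x - C x₀‖ * ((L x).mass : ℝ)) (𝓝 x₀) (𝓝 0) := by
    have ha : Tendsto (fun x => ‖C x - C x₀‖) (𝓝 x₀) (𝓝 0) := by
      have : Continuous fun x => ‖C x - C x₀‖ := by fun_prop
      simpa using this.tendsto x₀
    have hb : Tendsto (fun x => ((L x).mass : ℝ)) (𝓝 x₀) (𝓝 ((L x₀).mass : ℝ)) := by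
      have : Continuous fun x => ((L x).mass : ℝ) := by fun_prop
      exact this.tendsto x₀
    simpa using ha.mul hb
  have h3 : Tendsto (fun x => ∫ y, (C x - C x₀) y ∂(L x : Measure Y)) (𝓝 x₀) (𝓝 0) := by
    refine squeeze_zero_norm (fun x => ?_) h2
    refine (norm_integral_le_of_norm_le_const (C := ‖C x - C x₀‖)
      (ae_of_all _ fun y => (C x - C x₀).norm_coe_le_norm y)).trans (le_of_eq ?_)
    simp
    exact Or.inl rfl
  have h4 := h3.add h1
  rw [zero_add] at h4
  refine h4.congr fun x => ?_
  rw [← integral_add (integrable_of_continuous (C x - C x₀).continuous)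
    (integrable_of_continuous (C x₀).continuous)]
  simp [hC]

variable {V : Type*} [MeasurableSpace V]

lemma measurePreserving_cons (m : Measure V) [SigmaFinite m] (k : ℕ) :
    MeasurePreserving (fun p : V × (Fin k → V) => (Fin.cons p.1 p.2 : Fin (k + 1) → V))
      (m.prod (Measure.pi fun _ => m)) (Measure.pi fun _ => m) := by
  have h := (measurePreserving_piFinSuccAbove (fun _ : Fin (k + 1) => m) 0).symm
  convert h using 1
  ext p i
  simp [MeasurableEquiv.piFinSuccAbove]

lemma integral_pi_succ (m : Measure V) [SigmaFinite m] {k : ℕ} {G : (Fin (k + 1) → V) → ℝ}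
    (hG : Integrable G (Measure.pi fun _ => m)) :
    ∫ y, G y ∂(Measure.pi fun _ => m) =
      ∫ x, ∫ y : Fin k → V, G (Fin.cons x y) ∂(Measure.pi fun _ => m) ∂m := by
  have h := measurePreserving_cons m k
  have hemb : MeasurableEmbedding
      (fun p : V × (Fin k → V) => (Fin.cons p.1 p.2 : Fin (k + 1) → V)) := by
    convert (MeasurableEquiv.piFinSuccAbove (fun _ : Fin (k + 1) => V) 0).symm.measurableEmbedding
      using 1
    ext p i
    simp [MeasurableEquiv.piFinSuccAbove]
  rw [← h.integral_comp hemb, integral_prod]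
  exact (h.integrable_comp_emb hemb).2 hG

end Continuity

/-! ### Continuity of product integrals and of the pressure. -/

section ContinuityPi

universe u

lemma continuous_cons {V : Type*} [TopologicalSpace V] {k : ℕ} : Continuous
    fun p : V × (Fin k → V) => (Fin.cons p.1 p.2 : Fin (k + 1) → V) := by
  refine continuous_pi fun i => ?_
  refine Fin.cases ?_ (fun j => ?_) i
  · exact continuous_fst
  · simp only [Fin.cons_succ]; fun_prop

variable {V : Type u} [TopologicalSpace V] [CompactSpace V] [SecondCountableTopology V]
  [MeasurableSpace V] [BorelSpace V]

/-- Induction on `k` by Fubini. The parameter space is quantified inside the induction because the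
integrated coordinate joins it: the hypothesis is applied to `X × V`, which must live in the
universe of `X`. -/
lemma continuous_integral_pi (k : ℕ) : ∀ {X : Type u} [TopologicalSpace X]
    {L : X → FiniteMeasure V} (_ : Continuous L) {g : X → (Fin k → V) → ℝ}
    (_ : Continuous (Function.uncurry g)),
    Continuous fun x => ∫ y, g x y ∂(Measure.pi fun _ : Fin k => (L x : Measure V)) := by
  induction k with
  | zero =>
    intro X _ L hL g hg
    have : ∀ x, ∫ y, g x y ∂(Measure.pi fun _ : Fin 0 => (L x : Measure V)) =
        g x (fun i => Fin.elim0 i) := fun x => by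
      rw [Measure.pi_of_empty _ (fun i => Fin.elim0 i), integral_dirac]
    simp_rw [this]
    exact hg.comp (by fun_prop : Continuous fun x : X => (x, fun i : Fin 0 => (Fin.elim0 i : V)))
  | succ k ih =>
    intro X _ L hL g hg
    have : ∀ x, ∫ y, g x y ∂(Measure.pi fun _ : Fin (k + 1) => (L x : Measure V)) =
        ∫ v, ∫ y, g x (Fin.cons v y) ∂(Measure.pi fun _ : Fin k => (L x : Measure V))
          ∂(L x : Measure V) := fun x =>
      integral_pi_succ _ (integrable_of_continuous
        (hg.comp (by fun_prop : Continuous fun y => (x, y))))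
    simp_rw [this]
    refine continuous_integral_finiteMeasure hL ?_
    refine ih (X := X × V) (L := fun p => L p.1) (hL.comp continuous_fst)
      (g := fun p y => g p.1 (Fin.cons p.2 y)) ?_
    exact hg.comp ((by fun_prop : Continuous fun q : (X × V) × (Fin k → V) => q.1.1).prodMk
      (continuous_cons.comp
        (by fun_prop : Continuous fun q : (X × V) × (Fin k → V) => (q.1.2, q.2))))

/-- The single-user normalization
`∑_k m^{-(k - 1)} ∫ e^{-g_k(L, x, y)} L^{⊗(k-1)}(dy)`, with `m` the mass of `L`. -/
def siteWeight {V : Type*} [MeasurableSpace V] {kmax : ℕ} (g : Penalty V kmax)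
    (L : FiniteMeasure V) (x : V) : ℝ :=
  ∑ k : Fin kmax, ((L.mass : ℝ) ^ (k : ℕ))⁻¹ *
    ∫ y : Fin (k : ℕ) → V, Real.exp (-g k (L, Fin.cons x y)) ∂(Measure.pi fun _ => (L : Measure V))

/-- The limiting free energy `∫ log (siteWeight) dL`. -/
def pressure {V : Type*} [MeasurableSpace V] {kmax : ℕ} (g : Penalty V kmax)
    (L : FiniteMeasure V) : ℝ :=
  ∫ x, Real.log (siteWeight g L x) ∂(L : Measure V)

variable {kmax : ℕ}

lemma siteWeight_pos (hk : 0 < kmax) {g : Penalty V kmax} (hg : ∀ k, Continuous (g k))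
    {L : FiniteMeasure V} (hL : L.mass ≠ 0) (x : V) : 0 < siteWeight g L x := by
  have : Nonempty (Fin kmax) := ⟨⟨0, hk⟩⟩
  have hL' : (0 : ℝ) < L.mass := by exact_mod_cast pos_iff_ne_zero.2 hL
  refine Finset.sum_pos (fun k _ => ?_) Finset.univ_nonempty
  refine mul_pos (by positivity) ?_
  have hμ : (Measure.pi fun _ : Fin k => (L : Measure V)) ≠ 0 := by
    intro h
    have h1 := congrArg (fun m => m Set.univ) h
    simp only [Measure.pi_univ, Finset.prod_const, Measure.coe_zero, Pi.zero_apply,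
      pow_eq_zero_iff', ← FiniteMeasure.ennreal_mass] at h1
    exact hL (by exact_mod_cast h1.1)
  have := NeZero.mk hμ
  refine integral_exp_pos (integrable_of_continuous ?_)
  have h : Continuous fun y : Fin k → V => g k (L, Fin.cons x y) :=
    (hg k).comp (continuous_const.prodMk
      (continuous_cons.comp (by fun_prop : Continuous fun y : Fin k → V => (x, y))))
  fun_prop

/-- Joint continuity of `siteWeight` along a continuous family of penalties and measures. -/
lemma continuous_siteWeight_family {X : Type u} [TopologicalSpace X] {L : X → FiniteMeasure V}
    (hL : Continuous L) (hL0 : ∀ z, (L z).mass ≠ 0) {G : X → Penalty V kmax}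
    (hG : ∀ k : Fin kmax, Continuous fun p : X × (Fin ((k : ℕ) + 1) → V) => G p.1 k (L p.1, p.2)) :
    Continuous fun p : X × V => siteWeight (G p.1) (L p.1) p.2 := by
  refine continuous_finsetSum _ fun k _ => Continuous.mul ?_ ?_
  · have : Continuous fun p : X × V => ((L p.1).mass : ℝ) := by fun_prop
    exact (this.pow _).inv₀ fun p => pow_ne_zero _ (NNReal.coe_ne_zero.2 (hL0 p.1))
  · refine continuous_integral_pi k (X := X × V) (L := fun p => L p.1) (hL.comp continuous_fst)
      (g := fun p y => Real.exp (-G p.1 k (L p.1, Fin.cons p.2 y))) ?_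
    refine Real.continuous_exp.comp (Continuous.neg ?_)
    exact (hG k).comp ((by fun_prop : Continuous fun q : (X × V) × (Fin k → V) => q.1.1).prodMk
      (continuous_cons.comp
        (by fun_prop : Continuous fun q : (X × V) × (Fin k → V) => (q.1.2, q.2))))

lemma continuous_pressure_family (hk : 0 < kmax) {X : Type u} [TopologicalSpace X]
    {L : X → FiniteMeasure V} (hL : Continuous L) (hL0 : ∀ z, (L z).mass ≠ 0)
    {G : X → Penalty V kmax} (hGc : ∀ z k, Continuous (G z k))
    (hG : ∀ k : Fin kmax, Continuous fun p : X × (Fin ((k : ℕ) + 1) → V) => G p.1 k (L p.1, p.2)) :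
    Continuous fun z => pressure (G z) (L z) := by
  refine continuous_integral_finiteMeasure hL ?_
  exact (continuous_siteWeight_family hL hL0 hG).log
    fun p => (siteWeight_pos hk (hGc _) (hL0 _) _).ne'

lemma continuous_siteWeight {g : Penalty V kmax} (hg : ∀ k, Continuous (g k))
    {L : FiniteMeasure V} (hL : L.mass ≠ 0) : Continuous (siteWeight g L) := by
  have := continuous_siteWeight_family (X := PUnit.{u + 1}) (L := fun _ => L) continuous_const
    (fun _ => hL) (G := fun _ => g) (fun k => (hg k).comp (by fun_prop))
  exact this.comp (by fun_prop : Continuous fun x : V => (PUnit.unit, x))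

/-- The inverse powers of the mass restrict continuity to nonzero measures, an open set; hence the
passage through that subtype. -/
lemma tendsto_pressure (hk : 0 < kmax) {g : Penalty V kmax} (hg : ∀ k, Continuous (g k))
    {μ : FiniteMeasure V} (hμ : μ.mass ≠ 0) : Tendsto (pressure g) (𝓝 μ) (𝓝 (pressure g μ)) := by
  have hopen : IsOpen {L : FiniteMeasure V | L.mass ≠ 0} :=
    isOpen_ne.preimage FiniteMeasure.continuous_mass
  have : ContinuousOn (pressure g) {L : FiniteMeasure V | L.mass ≠ 0} := by
    rw [continuousOn_iff_continuous_domRestrict]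
    exact continuous_pressure_family hk (X := {L : FiniteMeasure V | L.mass ≠ 0})
      continuous_subtype_val (fun z => z.2) (fun _ => hg) (G := fun _ => g)
      (fun k => (hg k).comp (by fun_prop))
  exact (this.continuousAt (hopen.mem_nhds hμ)).tendsto

end ContinuityPi

/-! ### The product structure of the partition function -/

section Product

lemma diracFM_toMeasure {Y : Type*} [MeasurableSpace Y] (y : Y) :
    (diracFM y : Measure Y) = Measure.dirac y := rfl

lemma integral_smul_sum_diracFM {Y ι : Type*} [MeasurableSpace Y] (c : ℝ≥0) (s : Finset ι)
    (u : ι → Y) {φ : Y → ℝ} (hφ : Measurable φ) :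
    ∫ y, φ y ∂((c • ∑ i ∈ s, diracFM (u i) : FiniteMeasure Y) : Measure Y) =
      c * ∑ i ∈ s, φ (u i) := by
  rw [FiniteMeasure.toMeasure_smul, FiniteMeasure.toMeasure_sum, integral_smul_nnreal_measure,
    integral_finsetSum_measure]
  · simp [diracFM_toMeasure, integral_dirac' _ _ hφ.stronglyMeasurable, NNReal.smul_def]
  · intro i _
    rw [diracFM_toMeasure]
    exact integrable_dirac' hφ.stronglyMeasurable (by simp)

lemma integral_userEmpirical {V : Type*} [MeasurableSpace V] (lam : ℝ≥0) {n : ℕ} (x : Fin n → V)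
    {φ : V → ℝ} (hφ : Measurable φ) :
    ∫ y, φ y ∂(userEmpirical lam x : Measure V) = (lam : ℝ)⁻¹ * ∑ i, φ (x i) := by
  rw [userEmpirical, integral_smul_sum_diracFM _ _ _ hφ, NNReal.coe_inv]

lemma mass_eq_integral {Y : Type*} [MeasurableSpace Y] (ν : FiniteMeasure Y) :
    (ν.mass : ℝ) = ∫ _, (1 : ℝ) ∂(ν : Measure Y) := by
  simp
  rfl

lemma mass_userEmpirical {V : Type*} [MeasurableSpace V] (lam : ℝ≥0) {n : ℕ} (x : Fin n → V) :
    ((userEmpirical lam x).mass : ℝ) = (lam : ℝ)⁻¹ * n := by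
  rw [mass_eq_integral, integral_userEmpirical _ _ measurable_const]
  simp

/-- The penalty `γ f`. -/
def scale {V : Type*} [MeasurableSpace V] {kmax : ℕ} (γ : ℝ) (f : Penalty V kmax) :
    Penalty V kmax :=
  fun k p => γ * f k p

/-- The penalty `g` tilted by the test functions `φ`. -/
def tilt {V : Type*} [MeasurableSpace V] {kmax : ℕ} (g : Penalty V kmax)
    (φ : (k : Fin kmax) → (Fin ((k : ℕ) + 1) → V) → ℝ) : Penalty V kmax :=
  fun k p => g k p - φ k p.2

/-- The total integral `∑_k ∫ φ_k dν_k`. -/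
def pairing {V : Type*} [MeasurableSpace V] {kmax : ℕ}
    (φ : (k : Fin kmax) → (Fin ((k : ℕ) + 1) → V) → ℝ) (S : MeasureFamily V kmax) : ℝ :=
  ∑ k : Fin kmax, ∫ y, φ k y ∂(S k : Measure (Fin ((k : ℕ) + 1) → V))

variable {V : Type*} [MeasurableSpace V] {kmax : ℕ}

lemma weight_scale (f : Penalty V kmax) (γ : ℝ) (lam : ℝ≥0) {n : ℕ} (x : Fin n → V)
    (s : TrajectoryConfig n kmax) : weight f γ lam x s = weight (scale γ f) 1 lam x s := by
  simp [weight, energy, scale, Finset.mul_sum]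

lemma partitionFunction_scale (f : Penalty V kmax) (γ : ℝ) (lam : ℝ≥0) {n : ℕ} (x : Fin n → V) :
    partitionFunction f γ lam x = partitionFunction (scale γ f) 1 lam x := by
  simp only [partitionFunction, weight_scale f γ]

lemma gibbsProb_scale (f : Penalty V kmax) (γ : ℝ) (lam : ℝ≥0) {n : ℕ} (x : Fin n → V)
    (E : Set (MeasureFamily V kmax)) :
    gibbsProb f γ lam x E = gibbsProb (scale γ f) 1 lam x E := by
  simp only [gibbsProb, weight_scale f γ, partitionFunction_scale f γ]

lemma pairing_trajEmpirical {φ : (k : Fin kmax) → (Fin ((k : ℕ) + 1) → V) → ℝ}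
    (hφ : ∀ k, Measurable (φ k)) (lam : ℝ≥0) {n : ℕ} (x : Fin n → V)
    (s : TrajectoryConfig n kmax) :
    pairing φ (trajEmpirical lam x s) =
      (lam : ℝ)⁻¹ * ∑ i, φ (s i).1 (path x i (s i).2) := by
  classical
  have h1 : ∀ k : Fin kmax, ∫ y, φ k y ∂(trajEmpirical lam x s k : Measure _) = (lam : ℝ)⁻¹ *
      ∑ i, ∑ r : Fin k → Fin n, if s i = ⟨k, r⟩ then φ k (path x i r) else 0 := by
    intro k
    rw [trajEmpirical, integral_smul_sum_diracFM _ _ _ (hφ k), NNReal.coe_inv, Finset.sum_filter,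
      Fintype.sum_prod_type]
  have h2 : ∀ i, φ (s i).1 (path x i (s i).2) =
      ∑ k : Fin kmax, ∑ r : Fin k → Fin n, if s i = ⟨k, r⟩ then φ k (path x i r) else 0 := by
    intro i
    rw [← Fintype.sum_sigma' (fun (k : Fin kmax) (r : Fin k → Fin n) =>
      if s i = ⟨k, r⟩ then φ k (path x i r) else 0)]
    rw [Finset.sum_eq_single (s i)]
    · simp
    · intro t _ ht
      rw [if_neg]
      exact fun h => ht h.symm
    · simp
  simp_rw [pairing, h1, h2]
  rw [← Finset.mul_sum, Finset.sum_comm]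

lemma mass_trajEmpirical_le (lam : ℝ≥0) {n : ℕ} (x : Fin n → V)
    (s : TrajectoryConfig n kmax) (k : Fin kmax) :
    ((trajEmpirical lam x s k).mass : ℝ) ≤ (lam : ℝ)⁻¹ * n := by
  have h := pairing_trajEmpirical (φ := fun _ _ => (1 : ℝ)) (fun _ => measurable_const) lam x s
  simp only [pairing, ← mass_eq_integral, Finset.sum_const, Finset.card_univ, Fintype.card_fin,
    nsmul_eq_mul, mul_one] at h
  rw [← h]
  exact Finset.single_le_sum (f := fun k => ((trajEmpirical lam x s k).mass : ℝ))
    (fun _ _ => NNReal.coe_nonneg _) (Finset.mem_univ k)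

lemma weight_pos (g : Penalty V kmax) (γ : ℝ) (lam : ℝ≥0) {n : ℕ} (x : Fin n → V)
    (s : TrajectoryConfig n kmax) : 0 < weight g γ lam x s := by
  refine mul_pos (Finset.prod_pos fun i _ => ?_) (Real.exp_pos _)
  have : 0 < n := i.pos
  positivity

lemma partitionFunction_pos (hk : 0 < kmax) (g : Penalty V kmax) (γ : ℝ) (lam : ℝ≥0) {n : ℕ}
    (x : Fin n → V) : 0 < partitionFunction g γ lam x := by
  have : Nonempty (TrajectoryConfig n kmax) := ⟨fun i => ⟨⟨0, hk⟩, fun _ => i⟩⟩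
  exact Finset.sum_pos (fun s _ => weight_pos g γ lam x s) Finset.univ_nonempty

/-- Both the energy and the pairing with `Σ_λ` are sums over users, so an exponential change of
measure stays within the class of Gibbs weights. -/
lemma weight_tilt (g : Penalty V kmax) {φ : (k : Fin kmax) → (Fin ((k : ℕ) + 1) → V) → ℝ}
    (hφ : ∀ k, Measurable (φ k)) {lam : ℝ≥0} (hlam : lam ≠ 0) {n : ℕ} (x : Fin n → V)
    (s : TrajectoryConfig n kmax) :
    weight (tilt g φ) 1 lam x s =
      weight g 1 lam x s * Real.exp (lam * pairing φ (trajEmpirical lam x s)) := by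
  have hl : (lam : ℝ) ≠ 0 := NNReal.coe_ne_zero.2 hlam
  rw [pairing_trajEmpirical hφ, mul_inv_cancel_left₀ hl, weight, weight, mul_assoc, ← Real.exp_add]
  congr 2
  simp [energy, tilt]
  ring

lemma gibbsProb_eq_sum_div (g : Penalty V kmax) (γ : ℝ) (lam : ℝ≥0) {n : ℕ} (x : Fin n → V)
    (E : Set (MeasureFamily V kmax)) :
    gibbsProb g γ lam x E = (∑ s : TrajectoryConfig n kmax,
      {s | trajEmpirical lam x s ∈ E}.indicator (weight g γ lam x) s) /
        partitionFunction g γ lam x := by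
  classical
  rw [gibbsProb, Finset.sum_div]
  refine Finset.sum_congr rfl fun s _ => ?_
  by_cases hs : s ∈ {s | trajEmpirical lam x s ∈ E} <;> simp [hs]

lemma gibbsProb_nonneg (hk : 0 < kmax) (g : Penalty V kmax) (γ : ℝ) (lam : ℝ≥0) {n : ℕ}
    (x : Fin n → V) (E : Set (MeasureFamily V kmax)) : 0 ≤ gibbsProb g γ lam x E := by
  rw [gibbsProb_eq_sum_div]
  exact div_nonneg (Finset.sum_nonneg fun s _ =>
    Set.indicator_nonneg (fun s _ => (weight_pos g γ lam x s).le) s)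
    (partitionFunction_pos hk g γ lam x).le

/-- Comparison of Gibbs probabilities under tilting, on events on which the tilt is controlled. -/
lemma gibbsProb_le_of_tilt (hk : 0 < kmax) (g : Penalty V kmax)
    {φ : (k : Fin kmax) → (Fin ((k : ℕ) + 1) → V) → ℝ} (hφ : ∀ k, Measurable (φ k))
    {lam : ℝ≥0} (hlam : lam ≠ 0) {n : ℕ} (x : Fin n → V) {E E' : Set (MeasureFamily V kmax)}
    (hE : ∀ s, trajEmpirical lam x s ∈ E → trajEmpirical lam x s ∈ E') {c : ℝ}
    (hc : ∀ S ∈ E, c ≤ pairing φ S) :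
    gibbsProb g 1 lam x E ≤ Real.exp (-lam * c) * (partitionFunction (tilt g φ) 1 lam x /
      partitionFunction g 1 lam x) * gibbsProb (tilt g φ) 1 lam x E' := by
  rw [gibbsProb_eq_sum_div, gibbsProb_eq_sum_div]
  have hZ := partitionFunction_pos hk (tilt g φ) 1 lam x
  have hZ' := partitionFunction_pos hk g 1 lam x
  have : ∑ s : TrajectoryConfig n kmax,
      {s | trajEmpirical lam x s ∈ E}.indicator (weight g 1 lam x) s ≤
      Real.exp (-lam * c) * ∑ s : TrajectoryConfig n kmax,
      {s | trajEmpirical lam x s ∈ E'}.indicator (weight (tilt g φ) 1 lam x) s := by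
    rw [Finset.mul_sum]
    refine Finset.sum_le_sum fun s _ => ?_
    by_cases hs : trajEmpirical lam x s ∈ E
    · rw [Set.indicator_of_mem (by exact hs), Set.indicator_of_mem (by exact hE s hs),
        weight_tilt g hφ hlam, ← mul_assoc, mul_comm (Real.exp _), mul_assoc, ← Real.exp_add]
      refine le_mul_of_one_le_right (weight_pos g 1 lam x s).le (Real.one_le_exp ?_)
      have := mul_le_mul_of_nonneg_left (hc _ hs) lam.coe_nonneg
      linarith
    · rw [Set.indicator_of_notMem (by exact hs)]
      exact mul_nonneg (Real.exp_pos _).le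
        (Set.indicator_nonneg (fun s _ => (weight_pos (tilt g φ) 1 lam x s).le) s)
  calc _ ≤ _ := div_le_div_of_nonneg_right this hZ'.le
    _ = _ := by field_simp

lemma gibbsProb_univ (hk : 0 < kmax) (g : Penalty V kmax) (γ : ℝ) (lam : ℝ≥0) {n : ℕ}
    (x : Fin n → V) : gibbsProb g γ lam x Set.univ = 1 := by
  rw [gibbsProb_eq_sum_div]
  simp only [Set.mem_univ, Set.ofPred_true, Set.indicator_univ]
  exact div_self (partitionFunction_pos hk g γ lam x).ne'

lemma gibbsProb_mono (hk : 0 < kmax) (g : Penalty V kmax) (γ : ℝ) (lam : ℝ≥0) {n : ℕ}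
    (x : Fin n → V) {E E' : Set (MeasureFamily V kmax)}
    (hE : ∀ s, trajEmpirical lam x s ∈ E → trajEmpirical lam x s ∈ E') :
    gibbsProb g γ lam x E ≤ gibbsProb g γ lam x E' := by
  rw [gibbsProb_eq_sum_div, gibbsProb_eq_sum_div]
  refine div_le_div_of_nonneg_right (Finset.sum_le_sum fun s _ => ?_)
    (partitionFunction_pos hk g γ lam x).le
  exact Set.indicator_le_indicator_of_subset (fun s hs => hE s hs)
    (fun s => (weight_pos g γ lam x s).le) s

lemma gibbsProb_union_le (hk : 0 < kmax) (g : Penalty V kmax) (γ : ℝ) (lam : ℝ≥0) {n : ℕ}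
    (x : Fin n → V) (E E' : Set (MeasureFamily V kmax)) :
    gibbsProb g γ lam x (E ∪ E') ≤ gibbsProb g γ lam x E + gibbsProb g γ lam x E' := by
  simp only [gibbsProb_eq_sum_div]
  rw [← add_div, ← Finset.sum_add_distrib]
  refine div_le_div_of_nonneg_right (Finset.sum_le_sum fun s _ => ?_)
    (partitionFunction_pos hk g γ lam x).le
  have hw := (weight_pos g γ lam x s).le
  by_cases h : trajEmpirical lam x s ∈ E <;> by_cases h' : trajEmpirical lam x s ∈ E' <;>
    simp [Set.indicator, h, h', hw]

end Product

/-! ### Factorization over users. -/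

section ProductPi

universe u

variable {V : Type u} [TopologicalSpace V] [CompactSpace V] [SecondCountableTopology V]
  [MeasurableSpace V] [BorelSpace V] {kmax : ℕ}

lemma integral_pi_userEmpirical (lam : ℝ≥0) {n : ℕ} (x : Fin n → V) (k : ℕ) :
    ∀ {φ : (Fin k → V) → ℝ}, Continuous φ →
    ∫ y, φ y ∂(Measure.pi fun _ : Fin k => (userEmpirical lam x : Measure V)) =
      ((lam : ℝ) ^ k)⁻¹ * ∑ r : Fin k → Fin n, φ fun l => x (r l) := by
  induction k with
  | zero =>
    intro φ hφ
    rw [Measure.pi_of_empty _ (fun i => Fin.elim0 i), integral_dirac' _ _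
      hφ.measurable.stronglyMeasurable]
    simp only [pow_zero, inv_one, Finset.univ_unique, Finset.sum_singleton, one_mul]
    congr 1
    ext i
    exact Fin.elim0 i
  | succ k ih =>
    intro φ hφ
    have hc : Continuous fun p : V × (Fin k → V) => φ (Fin.cons p.1 p.2) := hφ.comp continuous_cons
    rw [integral_pi_succ _ (integrable_of_continuous hφ)]
    have : ∀ v, ∫ y, φ (Fin.cons v y)
        ∂(Measure.pi fun _ : Fin k => (userEmpirical lam x : Measure V)) =
        ((lam : ℝ) ^ k)⁻¹ * ∑ r : Fin k → Fin n, φ (Fin.cons v fun l => x (r l)) := fun v =>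
      ih (hc.comp (by fun_prop : Continuous fun y : Fin k → V => (v, y)))
    simp_rw [this]
    rw [integral_userEmpirical]
    · rw [← Finset.mul_sum, ← mul_assoc, pow_succ, mul_inv, mul_comm ((lam : ℝ) ^ k)⁻¹]
      congr 1
      rw [← (Fin.consEquiv fun _ : Fin (k + 1) => Fin n).sum_comp, Fintype.sum_prod_type]
      refine Finset.sum_congr rfl fun i _ => Finset.sum_congr rfl fun r _ => ?_
      congr 1
      ext l
      refine Fin.cases ?_ (fun l => ?_) l <;> simp [Fin.consEquiv]
    · refine (Continuous.measurable ?_)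
      refine continuous_const.mul (continuous_finsetSum _ fun r _ => ?_)
      exact hc.comp (by fun_prop : Continuous fun v : V => (v, fun l => x (r l)))

/-- The mass of `L_λ` is `n / λ`, so the factor `λ^{-k}` of the `k`-fold product integral cancels
against the mass normalization and leaves the relay weight `n^{-k}`. -/
lemma siteWeight_userEmpirical {g : Penalty V kmax} (hg : ∀ k, Continuous (g k)) {lam : ℝ≥0}
    (hlam : lam ≠ 0) {n : ℕ} (x : Fin n → V) (i : Fin n) :
    siteWeight g (userEmpirical lam x) (x i) = ∑ t : Trajectory n kmax,
      1 / (n : ℝ) ^ (t.1 : ℕ) * Real.exp (-g t.1 (userEmpirical lam x, path x i t.2)) := by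
  have hl : (lam : ℝ) ≠ 0 := NNReal.coe_ne_zero.2 hlam
  rw [siteWeight, Fintype.sum_sigma]
  refine Finset.sum_congr rfl fun k _ => ?_
  have hc : Continuous fun y : Fin k → V =>
      Real.exp (-g k (userEmpirical lam x, Fin.cons (x i) y)) := by
    have : Continuous fun y : Fin k → V => g k (userEmpirical lam x, Fin.cons (x i) y) :=
      (hg k).comp (continuous_const.prodMk
        (continuous_cons.comp (by fun_prop : Continuous fun y : Fin k → V => (x i, y))))
    fun_prop
  rw [integral_pi_userEmpirical lam x k hc, mass_userEmpirical, ← mul_assoc]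
  change _ = ∑ r : Fin k → Fin n, 1 / (n : ℝ) ^ (k : ℕ) *
    Real.exp (-g k (userEmpirical lam x, path x i r))
  rw [← Finset.mul_sum]
  congr 1
  rw [mul_pow, inv_pow, mul_inv, inv_inv]
  field_simp

/-- A sum over configurations of a product over users is the product of the single-user sums. Its
logarithm is `λ` times an integral against `L_λ`, with no error term. -/
theorem partitionFunction_eq_exp_pressure (hk : 0 < kmax) {g : Penalty V kmax}
    (hg : ∀ k, Continuous (g k)) {lam : ℝ≥0} (hlam : lam ≠ 0) {n : ℕ} (hn : n ≠ 0) (x : Fin n → V) :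
    partitionFunction g 1 lam x = Real.exp (lam * pressure g (userEmpirical lam x)) := by
  have hl : (lam : ℝ) ≠ 0 := NNReal.coe_ne_zero.2 hlam
  have hm : (userEmpirical lam x).mass ≠ 0 := by
    rw [← NNReal.coe_ne_zero, mass_userEmpirical]
    positivity
  have hprod : partitionFunction g 1 lam x = ∏ i, siteWeight g (userEmpirical lam x) (x i) := by
    simp_rw [siteWeight_userEmpirical hg hlam]
    rw [Finset.prod_univ_sum, Fintype.piFinset_univ, partitionFunction]
    refine Finset.sum_congr rfl fun s _ => ?_
    rw [Finset.prod_mul_distrib, weight, energy, ← Real.exp_sum]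
    simp
  have hc := continuous_siteWeight hg hm
  rw [hprod, pressure, integral_userEmpirical, mul_inv_cancel_left₀ hl, Real.exp_sum]
  · exact Finset.prod_congr rfl fun i _ => (Real.exp_log (siteWeight_pos hk hg hm _)).symm
  · exact Real.measurable_log.comp hc.measurable

end ProductPi

/-! ### The minimizing family and the free energy identity -/

section Optimal

open InformationTheory

lemma coe_real_sum {ι : Type*} (s : Finset ι) (u : ι → ℝ) :
    ((∑ i ∈ s, u i : ℝ) : EReal) = ∑ i ∈ s, (u i : EReal) := by
  classical
  induction s using Finset.induction_on with
  | empty => simp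
  | insert i s hi ih => rw [Finset.sum_insert hi, Finset.sum_insert hi, EReal.coe_add, ih]

lemma coe_ennreal_sum {ι : Type*} (s : Finset ι) (u : ι → ℝ≥0∞) :
    ((∑ i ∈ s, u i : ℝ≥0∞) : EReal) = ∑ i ∈ s, (u i : EReal) := by
  classical
  induction s using Finset.induction_on with
  | empty => simp
  | insert i s hi ih => rw [Finset.sum_insert hi, Finset.sum_insert hi, EReal.coe_ennreal_add, ih]

/-- The logarithm of the density of the minimizer with respect to `μ^{⊗k}`. -/
def logDensity {V : Type*} [MeasurableSpace V] {kmax : ℕ} (g : Penalty V kmax)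
    (μ : FiniteMeasure V) (k : Fin kmax) (y : Fin ((k : ℕ) + 1) → V) : ℝ :=
  -Real.log (siteWeight g μ (y 0)) - (k : ℕ) * Real.log μ.mass - g k (μ, y)

/-- The `k`-th component of the minimizer. -/
def optimalMeasure {V : Type*} [MeasurableSpace V] {kmax : ℕ} (g : Penalty V kmax)
    (μ : FiniteMeasure V) (k : Fin kmax) : Measure (Fin ((k : ℕ) + 1) → V) :=
  (Measure.pi fun _ => (μ : Measure V)).withDensity fun y =>
    ENNReal.ofReal (Real.exp (logDensity g μ k y))

open Classical in
/-- The minimizer of `J + S` over the asymptotic routeing strategies, for the penalty `g`. -/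
def optimal {V : Type*} [MeasurableSpace V] {kmax : ℕ} (g : Penalty V kmax)
    (μ : FiniteMeasure V) : MeasureFamily V kmax := fun k =>
  -- The fallback `0` does not occur for continuous penalties and nonzero `μ` when `kmax > 0`; see
  -- `coe_optimal`.
  if h : IsFiniteMeasure (optimalMeasure g μ k) then ⟨optimalMeasure g μ k, h⟩ else 0

/-- The relative entropy of `S` with respect to the minimizer. -/
def klSum {V : Type*} [MeasurableSpace V] {kmax : ℕ} (g : Penalty V kmax)
    (μ : FiniteMeasure V) (S : MeasureFamily V kmax) : ℝ≥0∞ :=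
  ∑ k : Fin kmax, klDiv (S k : Measure (Fin ((k : ℕ) + 1) → V)) (optimalMeasure g μ k)

universe u

variable {V : Type u} [TopologicalSpace V] [CompactSpace V] [SecondCountableTopology V]
  [MeasurableSpace V] [BorelSpace V] {kmax : ℕ}

lemma continuous_logDensity (hk : 0 < kmax) {g : Penalty V kmax} (hg : ∀ k, Continuous (g k))
    {μ : FiniteMeasure V} (hμ : μ.mass ≠ 0) (k : Fin kmax) : Continuous (logDensity g μ k) := by
  have h1 : Continuous fun y : Fin ((k : ℕ) + 1) → V => Real.log (siteWeight g μ (y 0)) :=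
    ((continuous_siteWeight hg hμ).comp (continuous_apply 0)).log
      fun y => (siteWeight_pos hk hg hμ _).ne'
  have h2 : Continuous fun y : Fin ((k : ℕ) + 1) → V => g k (μ, y) :=
    (hg k).comp (by fun_prop)
  unfold logDensity
  fun_prop

lemma isFiniteMeasure_optimalMeasure (hk : 0 < kmax) {g : Penalty V kmax}
    (hg : ∀ k, Continuous (g k)) {μ : FiniteMeasure V} (hμ : μ.mass ≠ 0) (k : Fin kmax) :
    IsFiniteMeasure (optimalMeasure g μ k) :=
  isFiniteMeasure_withDensity_ofReal
    (integrable_of_continuous (continuous_logDensity hk hg hμ k).rexp).2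

lemma coe_optimal (hk : 0 < kmax) {g : Penalty V kmax} (hg : ∀ k, Continuous (g k))
    {μ : FiniteMeasure V} (hμ : μ.mass ≠ 0) (k : Fin kmax) :
    (optimal g μ k : Measure (Fin ((k : ℕ) + 1) → V)) = optimalMeasure g μ k := by
  have h : optimal g μ k = ⟨_, isFiniteMeasure_optimalMeasure hk hg hμ k⟩ := dif_pos _
  rw [h]
  rfl

lemma continuous_penalty_cons {g : Penalty V kmax} (hg : ∀ k, Continuous (g k))
    (μ : FiniteMeasure V) (k : Fin kmax) :
    Continuous fun p : V × (Fin k → V) => g k (μ, Fin.cons p.1 p.2) :=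
  (hg k).comp (continuous_const.prodMk continuous_cons)

lemma continuous_integral_cons (μ : FiniteMeasure V) {k : ℕ} {G : V → (Fin k → V) → ℝ}
    (hG : Continuous (Function.uncurry G)) :
    Continuous fun v => ∫ y, G v y ∂(Measure.pi fun _ : Fin k => (μ : Measure V)) :=
  continuous_integral_pi k (X := V) (L := fun _ => μ) continuous_const hG

/-- Integration against the minimizer, disintegrated with respect to the starting point. -/
lemma pairing_optimal (hk : 0 < kmax) {g : Penalty V kmax} (hg : ∀ k, Continuous (g k))
    {μ : FiniteMeasure V} (hμ : μ.mass ≠ 0)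
    {φ : (k : Fin kmax) → (Fin ((k : ℕ) + 1) → V) → ℝ} (hφ : ∀ k, Continuous (φ k)) :
    pairing φ (optimal g μ) = ∫ v, (siteWeight g μ v)⁻¹ * ∑ k : Fin kmax,
      ((μ.mass : ℝ) ^ (k : ℕ))⁻¹ * ∫ y : Fin (k : ℕ) → V, φ k (Fin.cons v y) *
        Real.exp (-g k (μ, Fin.cons v y)) ∂(Measure.pi fun _ => (μ : Measure V))
      ∂(μ : Measure V) := by
  have hm : (0 : ℝ) < μ.mass := by exact_mod_cast pos_iff_ne_zero.2 hμ
  have hF : ∀ k : Fin kmax, Continuous fun v : V => ∫ y : Fin (k : ℕ) → V, φ k (Fin.cons v y) *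
        Real.exp (-g k (μ, Fin.cons v y)) ∂(Measure.pi fun _ => (μ : Measure V)) := fun k =>
    continuous_integral_cons μ (((hφ k).comp continuous_cons).mul
      (continuous_penalty_cons hg μ k).neg.rexp)
  have hA : Continuous fun v => (siteWeight g μ v)⁻¹ :=
    (continuous_siteWeight hg hμ).inv₀ fun v => (siteWeight_pos hk hg hμ v).ne'
  simp_rw [Finset.mul_sum]
  have hAF : ∀ k : Fin kmax, Integrable (fun v : V => (siteWeight g μ v)⁻¹ *
      (((μ.mass : ℝ) ^ (k : ℕ))⁻¹ * ∫ y : Fin (k : ℕ) → V, φ k (Fin.cons v y) *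
        Real.exp (-g k (μ, Fin.cons v y)) ∂(Measure.pi fun _ => (μ : Measure V)))) μ := fun k =>
    integrable_of_continuous (hA.mul (continuous_const.mul (hF k)))
  rw [integral_finsetSum _ fun k _ => hAF k]
  refine Finset.sum_congr rfl fun k _ => ?_
  rw [coe_optimal hk hg hμ, optimalMeasure, integral_withDensity_eq_integral_toReal_smul
    (continuous_logDensity hk hg hμ k).rexp.measurable.ennreal_ofReal (by simp), integral_pi_succ]
  · refine integral_congr_ae (ae_of_all _ fun v => ?_)
    simp only [← integral_const_mul]
    refine integral_congr_ae (ae_of_all _ fun y => ?_)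
    simp only [ENNReal.toReal_ofReal (Real.exp_pos _).le, smul_eq_mul, logDensity, Fin.cons_zero]
    rw [sub_eq_add_neg, Real.exp_add, Real.exp_sub, Real.exp_neg,
      Real.exp_log (siteWeight_pos hk hg hμ v), Real.exp_nat_mul, Real.exp_log hm]
    field_simp
  · have h := (continuous_logDensity hk hg hμ k).rexp.mul (hφ k)
    refine (integrable_of_continuous h).congr (ae_of_all _ fun y => ?_)
    simp [ENNReal.toReal_ofReal (Real.exp_pos _).le]

lemma integral_siteWeight_mul {g : Penalty V kmax} (μ : FiniteMeasure V) (h : V → ℝ) (v : V) :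
    (∑ k : Fin kmax, ((μ.mass : ℝ) ^ (k : ℕ))⁻¹ * ∫ y : Fin (k : ℕ) → V, h v *
        Real.exp (-g k (μ, Fin.cons v y)) ∂(Measure.pi fun _ => (μ : Measure V))) =
      h v * siteWeight g μ v := by
  rw [siteWeight, Finset.mul_sum]
  refine Finset.sum_congr rfl fun k _ => ?_
  rw [integral_const_mul]
  ring

lemma integral_marginal {S : MeasureFamily V kmax} {h : V → ℝ} (hh : Continuous h) :
    ∫ v, h v ∂((∑ k, (S k).map (fun y => y 0) : FiniteMeasure V) : Measure V) =
      pairing (fun _ y => h (y 0)) S := by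
  rw [FiniteMeasure.toMeasure_sum, integral_finsetSum_measure]
  · refine Finset.sum_congr rfl fun k _ => ?_
    rw [FiniteMeasure.toMeasure_map,
      integral_map (measurable_pi_apply 0).aemeasurable hh.aestronglyMeasurable]
  · exact fun k _ => integrable_of_continuous hh

lemma IsRouteingStrategy.pairing_eq {μ : FiniteMeasure V} {S : MeasureFamily V kmax}
    (hS : IsRouteingStrategy μ S) {h : V → ℝ} (hh : Continuous h) :
    pairing (fun _ y => h (y 0)) S = ∫ v, h v ∂(μ : Measure V) := by
  rw [← integral_marginal hh, hS]

/-- Dividing by `siteWeight` normalizes the law of the hop number and relays given the starting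
point, so the starting points are distributed according to `μ`. -/
lemma pairing_optimal_start (hk : 0 < kmax) {g : Penalty V kmax} (hg : ∀ k, Continuous (g k))
    {μ : FiniteMeasure V} (hμ : μ.mass ≠ 0) {h : V → ℝ} (hh : Continuous h) :
    pairing (fun _ y => h (y 0)) (optimal g μ) = ∫ v, h v ∂(μ : Measure V) := by
  rw [pairing_optimal hk hg hμ (φ := fun _ y => h (y 0)) fun k => hh.comp (continuous_apply 0)]
  refine integral_congr_ae (ae_of_all _ fun v => ?_)
  simp only [Fin.cons_zero, integral_siteWeight_mul]
  have := siteWeight_pos hk hg hμ v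
  field_simp

lemma pairing_exp_optimal (hk : 0 < kmax) {g : Penalty V kmax} (hg : ∀ k, Continuous (g k))
    {μ : FiniteMeasure V} (hμ : μ.mass ≠ 0)
    {φ : (k : Fin kmax) → (Fin ((k : ℕ) + 1) → V) → ℝ} (hφ : ∀ k, Continuous (φ k)) :
    pairing (fun k y => Real.exp (φ k y)) (optimal g μ) =
      ∫ v, siteWeight (tilt g φ) μ v / siteWeight g μ v ∂(μ : Measure V) := by
  rw [pairing_optimal hk hg hμ fun k => (hφ k).rexp]
  refine integral_congr_ae (ae_of_all _ fun v => ?_)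
  simp only [div_eq_inv_mul]
  congr 1
  refine Finset.sum_congr rfl fun k _ => ?_
  simp only [← Real.exp_add, tilt]
  congr 2
  ext y
  congr 1
  ring

lemma continuous_tilt {g : Penalty V kmax} (hg : ∀ k, Continuous (g k))
    {φ : (k : Fin kmax) → (Fin ((k : ℕ) + 1) → V) → ℝ} (hφ : ∀ k, Continuous (φ k))
    (k : Fin kmax) : Continuous (tilt g φ k) :=
  (hg k).sub ((hφ k).comp continuous_snd)

/-- This is `log r ≤ r - 1` for the ratio `r` of the tilted and untilted site weights, integrated
over `μ`. It lets test functions from the unconstrained entropy duality serve in the Legendre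
transform of the pressure. -/
lemma pressure_tilt_sub_le (hk : 0 < kmax) {g : Penalty V kmax} (hg : ∀ k, Continuous (g k))
    {μ : FiniteMeasure V} (hμ : μ.mass ≠ 0)
    {φ : (k : Fin kmax) → (Fin ((k : ℕ) + 1) → V) → ℝ} (hφ : ∀ k, Continuous (φ k)) :
    pressure (tilt g φ) μ - pressure g μ ≤
      pairing (fun k y => Real.exp (φ k y)) (optimal g μ) - μ.mass := by
  have hgt := continuous_tilt hg hφ
  have hc := continuous_siteWeight hg hμ
  have hct := continuous_siteWeight hgt hμ
  have hp := siteWeight_pos hk hg hμ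
  have hpt := siteWeight_pos hk hgt hμ
  have hl := integrable_of_continuous (ν := (μ : Measure V)) (hc.log fun v => (hp v).ne')
  have hlt := integrable_of_continuous (ν := (μ : Measure V)) (hct.log fun v => (hpt v).ne')
  have hd := integrable_of_continuous (ν := (μ : Measure V)) (hct.div₀ hc fun v => (hp v).ne')
  rw [pairing_exp_optimal hk hg hμ hφ, mass_eq_integral, pressure, pressure,
    ← integral_sub hlt hl, ← integral_sub hd (integrable_const _)]
  refine integral_mono (hlt.sub hl) (hd.sub (integrable_const _)) fun v => ?_
  rw [← Real.log_div (hpt v).ne' (hp v).ne']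
  exact Real.log_le_sub_one_of_pos (div_pos (hpt v) (hp v))

lemma pairing_sub {φ φ' : (k : Fin kmax) → (Fin ((k : ℕ) + 1) → V) → ℝ}
    (hφ : ∀ k, Continuous (φ k)) (hφ' : ∀ k, Continuous (φ' k)) (S : MeasureFamily V kmax) :
    pairing (fun k y => φ k y - φ' k y) S = pairing φ S - pairing φ' S := by
  simp only [pairing]
  rw [← Finset.sum_sub_distrib]
  exact Finset.sum_congr rfl fun k _ => integral_sub (integrable_of_continuous (hφ k))
    (integrable_of_continuous (hφ' k))

lemma pairing_const_mul (c : ℝ) (φ : (k : Fin kmax) → (Fin ((k : ℕ) + 1) → V) → ℝ)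
    (S : MeasureFamily V kmax) : pairing (fun k y => c * φ k y) S = c * pairing φ S := by
  simp only [pairing, integral_const_mul, Finset.mul_sum]

variable [TopologicalSpace.MetrizableSpace V]

lemma isRouteingStrategy_optimal (hk : 0 < kmax) {g : Penalty V kmax} (hg : ∀ k, Continuous (g k))
    {μ : FiniteMeasure V} (hμ : μ.mass ≠ 0) : IsRouteingStrategy μ (optimal g μ) := by
  refine FiniteMeasure.ext_of_forall_integral_eq fun h => ?_
  rw [integral_marginal h.continuous, pairing_optimal_start hk hg hμ h.continuous]

lemma relayMeasure_mass (S : MeasureFamily V kmax) :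
    ((relayMeasure S).mass : ℝ) = ∑ k : Fin kmax, (k : ℕ) * ((S k).mass : ℝ) := by
  rw [mass_eq_integral, relayMeasure, FiniteMeasure.toMeasure_sum, integral_finsetSum_measure
    fun k _ => integrable_const _]
  refine Finset.sum_congr rfl fun k _ => ?_
  rw [FiniteMeasure.toMeasure_sum, integral_finsetSum_measure fun k _ => integrable_const _]
  simp_rw [FiniteMeasure.toMeasure_map]
  rw [Finset.sum_congr rfl fun (l : Fin k) _ =>
    integral_map (μ := (S k : Measure (Fin ((k : ℕ) + 1) → V))) (φ := fun y => y l.succ)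
      (measurable_pi_apply l.succ).aemeasurable
      (f := fun _ => (1 : ℝ)) aestronglyMeasurable_const]
  simp [mass_eq_integral]

/-- The variational functional is a relative entropy with respect to its minimizer. -/
theorem klSum_eq_freeEnergy (hk : 0 < kmax) {g : Penalty V kmax} (hg : ∀ k, Continuous (g k))
    {μ : FiniteMeasure V} (hμ : μ.mass ≠ 0) {S : MeasureFamily V kmax}
    (hS : IsRouteingStrategy μ S) :
    (klSum g μ S : EReal) = entropyJ μ S + ((limitPenalty g μ S + pressure g μ : ℝ) : EReal) := by
  have hm : (0 : ℝ) < μ.mass := by exact_mod_cast pos_iff_ne_zero.2 hμ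
  have hlc := continuous_logDensity hk hg hμ
  have hshift : ∀ k : Fin kmax,
      (klDiv (S k : Measure (Fin ((k : ℕ) + 1) → V)) (optimalMeasure g μ k) : EReal) =
      (klDiv (S k : Measure (Fin ((k : ℕ) + 1) → V))
        (Measure.pi fun _ => (μ : Measure V)) : EReal) +
        ((∫ y, (Real.exp (logDensity g μ k y) - 1) ∂(Measure.pi fun _ => (μ : Measure V)) -
          ∫ y, logDensity g μ k y ∂(S k : Measure (Fin ((k : ℕ) + 1) → V)) : ℝ) : EReal) :=
    fun k => klDiv_withDensity_exp (hlc k)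
  have h1 : ∀ k : Fin kmax,
      ∫ y, (Real.exp (logDensity g μ k y) - 1) ∂(Measure.pi fun _ => (μ : Measure V)) =
        ((optimal g μ k).mass : ℝ) - (μ.mass : ℝ) ^ ((k : ℕ) + 1) := by
    intro k
    rw [integral_sub (integrable_of_continuous (hlc k).rexp) (integrable_const _), mass_eq_integral,
      coe_optimal hk hg hμ, optimalMeasure, integral_withDensity_eq_integral_toReal_smul
        (hlc k).rexp.measurable.ennreal_ofReal (by simp)]
    congr 1
    · simp [ENNReal.toReal_ofReal (Real.exp_pos _).le]
    · simp [Measure.real, Measure.pi_univ]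
      rfl
  -- This total mass cancels the one-hop term `μ(V)` split off in `h4`. What remains is the constant
  -- `-∑_{k ≥ 2} μ(V)^k` of `J`.
  have h2 : ∑ k : Fin kmax, ((optimal g μ k).mass : ℝ) = μ.mass := by
    simp_rw [mass_eq_integral]
    exact pairing_optimal_start hk hg hμ (h := fun _ => (1 : ℝ)) continuous_const
  have hw : Continuous fun v => Real.log (siteWeight g μ v) :=
    (continuous_siteWeight hg hμ).log fun v => (siteWeight_pos hk hg hμ v).ne'
  have h3 : ∑ k : Fin kmax, ∫ y, logDensity g μ k y ∂(S k : Measure (Fin ((k : ℕ) + 1) → V)) =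
      -pressure g μ - (relayMeasure S).mass * Real.log μ.mass - limitPenalty g μ S := by
    have : ∀ k : Fin kmax, ∫ y, logDensity g μ k y ∂(S k : Measure (Fin ((k : ℕ) + 1) → V)) =
        -(∫ y, Real.log (siteWeight g μ (y 0)) ∂(S k : Measure (Fin ((k : ℕ) + 1) → V))) -
          (k : ℕ) * ((S k).mass : ℝ) * Real.log μ.mass -
          ∫ y, g k (μ, y) ∂(S k : Measure (Fin ((k : ℕ) + 1) → V)) := by
      intro k
      have hgk : Continuous fun y : Fin ((k : ℕ) + 1) → V => g k (μ, y) := (hg k).comp (by fun_prop)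
      have hwk : Continuous fun y : Fin ((k : ℕ) + 1) → V => -Real.log (siteWeight g μ (y 0)) :=
        (hw.comp (continuous_apply 0)).neg
      have hwc : Continuous fun y : Fin ((k : ℕ) + 1) → V =>
          -Real.log (siteWeight g μ (y 0)) - (k : ℕ) * Real.log μ.mass := hwk.sub continuous_const
      simp only [logDensity]
      rw [integral_sub (integrable_of_continuous hwc) (integrable_of_continuous hgk),
        integral_sub (integrable_of_continuous hwk) (integrable_const _), integral_neg,
        mass_eq_integral (S k)]
      simp only [integral_const, smul_eq_mul]
      ring
    simp_rw [this]
    -- The marginal constraint on `S` enters here: it turns the integral of the log site weight at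
    -- the starting point into the pressure, which does not depend on `S`.
    rw [Finset.sum_sub_distrib, Finset.sum_sub_distrib, Finset.sum_neg_distrib, relayMeasure_mass,
      Finset.sum_mul, pressure, ← hS.pairing_eq hw]
    rfl
  have h4 : ∑ k : Fin kmax, (μ.mass : ℝ) ^ ((k : ℕ) + 1) =
      μ.mass + ∑ k ∈ Finset.Icc 2 kmax, (μ.mass : ℝ) ^ k := by
    rw [Fin.sum_univ_eq_sum_range fun k => (μ.mass : ℝ) ^ (k + 1)]
    obtain ⟨K, rfl⟩ := Nat.exists_eq_succ_of_ne_zero hk.ne'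
    rw [Nat.succ_eq_add_one, Finset.sum_range_succ', zero_add, pow_one, add_comm]
    congr 1
    rw [Finset.range_eq_Ico, Finset.sum_Ico_add' (fun k => (μ.mass : ℝ) ^ (k + 1)) 0 K 1,
      Finset.sum_Ico_add' (fun k => (μ.mass : ℝ) ^ k) _ _ 1]
    rfl
  rw [klSum, coe_ennreal_sum, Finset.sum_congr rfl fun k _ => hshift k, Finset.sum_add_distrib,
    ← coe_real_sum, ← coe_ennreal_sum, Finset.sum_sub_distrib, h3,
    Finset.sum_congr rfl fun k _ => h1 k, Finset.sum_sub_distrib, h2, h4, entropyJ,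
    sub_eq_add_neg (G := EReal), ← EReal.coe_neg, add_assoc, add_assoc,
    ← EReal.coe_add, ← EReal.coe_add]
  congr 2
  ring

/-- Change of the reference penalty in the relative entropy. -/
lemma klSum_tilt (hk : 0 < kmax) {g : Penalty V kmax} (hg : ∀ k, Continuous (g k))
    {μ : FiniteMeasure V} (hμ : μ.mass ≠ 0) {S : MeasureFamily V kmax}
    (hS : IsRouteingStrategy μ S) {φ : (k : Fin kmax) → (Fin ((k : ℕ) + 1) → V) → ℝ}
    (hφ : ∀ k, Continuous (φ k)) :
    (klSum g μ S : EReal) = (klSum (tilt g φ) μ S : EReal) +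
      ((pairing φ S - (pressure (tilt g φ) μ - pressure g μ) : ℝ) : EReal) := by
  rw [klSum_eq_freeEnergy hk hg hμ hS, klSum_eq_freeEnergy hk (continuous_tilt hg hφ) hμ hS,
    add_assoc, ← EReal.coe_add]
  congr 2
  have : limitPenalty (tilt g φ) μ S = limitPenalty g μ S - pairing φ S := by
    refine pairing_sub (φ := fun k y => g k (μ, y)) (fun k => ?_) hφ S
    exact (hg k).comp (by fun_prop)
  rw [this]
  ring

lemma klSum_optimal (hk : 0 < kmax) {g : Penalty V kmax} (hg : ∀ k, Continuous (g k))
    {μ : FiniteMeasure V} (hμ : μ.mass ≠ 0) : klSum g μ (optimal g μ) = 0 := by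
  refine Finset.sum_eq_zero fun k _ => ?_
  have := isFiniteMeasure_optimalMeasure hk hg hμ k
  rw [coe_optimal hk hg hμ, klDiv_self]

lemma eq_optimal_of_klSum_eq_zero (hk : 0 < kmax) {g : Penalty V kmax}
    (hg : ∀ k, Continuous (g k)) {μ : FiniteMeasure V} (hμ : μ.mass ≠ 0)
    {S : MeasureFamily V kmax} (hS : klSum g μ S = 0) : S = optimal g μ := by
  ext1 k
  apply FiniteMeasure.toMeasure_injective
  have := isFiniteMeasure_optimalMeasure hk hg hμ k
  rw [coe_optimal hk hg hμ]
  exact klDiv_eq_zero_iff.1 (Finset.sum_eq_zero_iff.1 hS k (Finset.mem_univ k))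

lemma continuous_scale {f : Penalty V kmax} (hf : ∀ k, Continuous (f k)) (γ : ℝ) (k : Fin kmax) :
    Continuous (scale γ f k) :=
  continuous_const.mul (hf k)

lemma explicitMeasure_eq_optimalMeasure (hk : 0 < kmax) {f : Penalty V kmax}
    (hf : ∀ k, Continuous (f k)) (γ : ℝ) {μ : FiniteMeasure V} (hμ : μ.mass ≠ 0) (k : Fin kmax) :
    explicitMeasure f γ μ k = optimalMeasure (scale γ f) μ k := by
  have hm : (0 : ℝ) < μ.mass := by exact_mod_cast pos_iff_ne_zero.2 hμ
  have hA : ∀ v, normalizerA f γ μ v = (siteWeight (scale γ f) μ v)⁻¹ := fun v => by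
    simp [normalizerA, siteWeight, scale]
  rw [explicitMeasure, optimalMeasure]
  congr 1
  ext y
  congr 1
  rw [hA, logDensity, sub_eq_add_neg, Real.exp_add, Real.exp_sub, Real.exp_neg, Real.exp_log
    (siteWeight_pos hk (continuous_scale hf γ) hμ _), Real.exp_nat_mul, Real.exp_log hm]
  simp [scale, div_eq_mul_inv]

end Optimal

/-! ### The rate function as a Legendre transform -/

section Rate

open InformationTheory

open Classical in
/-- The rate function of the empirical measures under the Gibbs distribution with penalty `g`. -/
def gibbsRate {V : Type*} [MeasurableSpace V] {kmax : ℕ} (g : Penalty V kmax)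
    (μ : FiniteMeasure V) (S : MeasureFamily V kmax) : EReal :=
  if IsRouteingStrategy μ S then (klSum g μ S : EReal) else ⊤

lemma coe_ennreal_ofReal_of_nonneg {r : ℝ} (hr : 0 ≤ r) :
    ((ENNReal.ofReal r : ℝ≥0∞) : EReal) = (r : EReal) := by
  rw [EReal.coe_ennreal_ofReal, max_eq_left hr]

/-- Distributing the strict bound over the summands allows a test function to be chosen for each hop
number separately, also when some entropies are infinite. -/
lemma exists_real_lt_of_lt_sum {ι : Type*} (s : Finset ι) (u : ι → ℝ≥0∞) :
    ∀ {a : ℝ}, (a : EReal) < ∑ i ∈ s, (u i : EReal) →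
      ∃ b : ι → ℝ, (∀ i ∈ s, (b i : EReal) < u i) ∧ a < ∑ i ∈ s, b i := by
  classical
  induction s using Finset.induction_on with
  | empty => intro a ha; exact ⟨0, by simp, by simpa using ha⟩
  | insert i s hi ih =>
    intro a ha
    rw [Finset.sum_insert hi] at ha
    obtain ⟨c, hc, d, hd, ha⟩ : ∃ c < (u i : EReal), ∃ d < ∑ j ∈ s, (u j : EReal),
        (a : EReal) < c + d := by
      by_contra! hcon
      exact absurd ha (not_lt.2 (EReal.add_le_of_forall_lt hcon))
    obtain ⟨c', hc', hci⟩ := EReal.lt_iff_exists_real_btwn.1 hc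
    obtain ⟨d', hd', hds⟩ := EReal.lt_iff_exists_real_btwn.1 hd
    obtain ⟨b, hb, hsum⟩ := ih hds
    refine ⟨Function.update b i c', fun j hj => ?_, ?_⟩
    · rcases Finset.mem_insert.1 hj with rfl | hjs
      · simpa using hci
      · rw [Function.update_of_ne (by rintro rfl; exact hi hjs)]
        exact hb j hjs
    · rw [Finset.sum_insert hi, Function.update_self]
      have h1 : ∑ j ∈ s, Function.update b i c' j = ∑ j ∈ s, b j :=
        Finset.sum_congr rfl fun j hj => Function.update_of_ne (by rintro rfl; exact hi hj) _ _
      have h2 : (a : EReal) < ((c' + d' : ℝ) : EReal) := by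
        rw [EReal.coe_add]
        exact ha.trans_le (add_le_add hc'.le hd'.le)
      have h3 : a < c' + d' := EReal.coe_lt_coe_iff.1 h2
      rw [h1]
      linarith

universe u

variable {V : Type u} [TopologicalSpace V] [CompactSpace V] [SecondCountableTopology V]
  [MeasurableSpace V] [BorelSpace V] [TopologicalSpace.MetrizableSpace V] {kmax : ℕ}
  {g : Penalty V kmax} {μ : FiniteMeasure V}

lemma gibbsRate_nonneg (S : MeasureFamily V kmax) : 0 ≤ gibbsRate g μ S := by
  unfold gibbsRate
  split_ifs
  · exact EReal.coe_ennreal_nonneg _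
  · exact le_top

lemma IsRouteingStrategy.mass_le {S : MeasureFamily V kmax} (hS : IsRouteingStrategy μ S)
    (k : Fin kmax) : (S k).mass ≤ μ.mass := by
  have h := hS.pairing_eq (h := fun _ => (1 : ℝ)) continuous_const
  simp only [pairing, ← mass_eq_integral] at h
  rw [← NNReal.coe_le_coe, ← h]
  exact Finset.single_le_sum (f := fun k => ((S k).mass : ℝ)) (fun _ _ => NNReal.coe_nonneg _)
    (Finset.mem_univ k)

/-- A tilt depending only on the starting point factors out of the site weight. The pressure is
therefore affine in such tilts, which forces the Legendre transform to be infinite off the routeing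
strategies. -/
lemma pressure_tilt_start (hk : 0 < kmax) (hg : ∀ k, Continuous (g k)) (hμ : μ.mass ≠ 0)
    {h : V → ℝ} (hh : Continuous h) :
    pressure (tilt g fun _ y => h (y 0)) μ = pressure g μ + ∫ v, h v ∂(μ : Measure V) := by
  have hw : Continuous fun v => Real.log (siteWeight g μ v) :=
    (continuous_siteWeight hg hμ).log fun v => (siteWeight_pos hk hg hμ v).ne'
  rw [pressure, pressure, ← integral_add (integrable_of_continuous hw)
    (integrable_of_continuous hh)]
  refine integral_congr_ae (ae_of_all _ fun v => ?_)
  have : siteWeight (tilt g fun _ y => h (y 0)) μ v = Real.exp (h v) * siteWeight g μ v := by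
    rw [← integral_siteWeight_mul μ (fun v => Real.exp (h v)), siteWeight]
    refine Finset.sum_congr rfl fun k _ => ?_
    congr 2
    ext y
    rw [← Real.exp_add]
    simp [tilt]
    ring
  simp only [this]
  rw [Real.log_mul (Real.exp_pos _).ne' (siteWeight_pos hk hg hμ v).ne', Real.log_exp, add_comm]

/-- Together with `legendre_le_gibbsRate` this says that `gibbsRate` is the Legendre transform of
the pressure difference. For a strategy, the separate entropy duals are combined through
`pressure_tilt_sub_le`. -/
lemma exists_lt_legendre (hk : 0 < kmax) (hg : ∀ k, Continuous (g k)) (hμ : μ.mass ≠ 0)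
    {S : MeasureFamily V kmax} {a : ℝ} (ha : (a : EReal) < gibbsRate g μ S) :
    ∃ φ : (k : Fin kmax) → (Fin ((k : ℕ) + 1) → V) → ℝ, (∀ k, Continuous (φ k)) ∧
      a < pairing φ S - (pressure (tilt g φ) μ - pressure g μ) := by
  by_cases hS : IsRouteingStrategy μ S
  · rw [gibbsRate, if_pos hS, klSum, coe_ennreal_sum] at ha
    obtain ⟨b, hb, hab⟩ := exists_real_lt_of_lt_sum _ _ ha
    have := fun k => isFiniteMeasure_optimalMeasure hk hg hμ k
    choose φ hφ hgap using fun k => exists_continuous_lt_entropyGap (hb k (Finset.mem_univ k))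
    refine ⟨φ, hφ, hab.trans_le ?_⟩
    have h1 : ∑ k, b k ≤ ∑ k : Fin kmax, entropyGap (S k : Measure (Fin ((k : ℕ) + 1) → V))
        (optimalMeasure g μ k) (φ k) := Finset.sum_le_sum fun k _ => (hgap k).le
    have h2 : ∑ k : Fin kmax, entropyGap (S k : Measure (Fin ((k : ℕ) + 1) → V))
        (optimalMeasure g μ k) (φ k) = pairing φ S -
          (pairing (fun k y => Real.exp (φ k y)) (optimal g μ) - μ.mass) := by
      have h3 := pairing_sub (fun k => (hφ k).rexp) (φ' := fun _ _ => (1 : ℝ))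
        (fun k => continuous_const) (optimal g μ)
      rw [pairing_optimal_start hk hg hμ (h := fun _ => (1 : ℝ)) continuous_const,
        ← mass_eq_integral] at h3
      rw [← h3]
      simp only [entropyGap, Finset.sum_sub_distrib, pairing, coe_optimal hk hg hμ]
    have := pressure_tilt_sub_le hk hg hμ hφ
    linarith
  · obtain ⟨h, hne⟩ : ∃ h : BoundedContinuousFunction V ℝ,
        ∫ v, h v ∂((∑ k, (S k).map (fun y => y 0) : FiniteMeasure V) : Measure V) ≠
          ∫ v, h v ∂(μ : Measure V) := by
      by_contra! hcon
      exact hS (FiniteMeasure.ext_of_forall_integral_eq hcon)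
    rw [integral_marginal h.continuous] at hne
    set D := pairing (fun _ y => h (y 0)) S - ∫ v, h v ∂(μ : Measure V) with hD
    have hD0 : D ≠ 0 := sub_ne_zero.2 hne
    -- Scaling a function that detects the marginal defect `D` gives the Legendre value `t * D = a +
    -- 1`.
    let t := (a + 1) / D
    have hth : Continuous fun v => t * h v := continuous_const.mul h.continuous
    refine ⟨fun _ y => t * h (y 0), fun k => hth.comp (continuous_apply 0), ?_⟩
    rw [pressure_tilt_start hk hg hμ (h := fun v => t * h v) hth, integral_const_mul,
      pairing_const_mul t (fun _ y => h (y 0))]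
    have : t * D = a + 1 := div_mul_cancel₀ _ hD0
    rw [hD] at this
    linarith

/-- On routeing strategies the deficit is the relative entropy with respect to the tilted minimizer,
hence nonnegative. -/
lemma legendre_le_gibbsRate (hk : 0 < kmax) (hg : ∀ k, Continuous (g k)) (hμ : μ.mass ≠ 0)
    (S : MeasureFamily V kmax) {φ : (k : Fin kmax) → (Fin ((k : ℕ) + 1) → V) → ℝ}
    (hφ : ∀ k, Continuous (φ k)) :
    ((pairing φ S - (pressure (tilt g φ) μ - pressure g μ) : ℝ) : EReal) ≤ gibbsRate g μ S := by
  by_cases hS : IsRouteingStrategy μ S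
  · rw [gibbsRate, if_pos hS, klSum_tilt hk hg hμ hS hφ]
    exact le_add_of_nonneg_left (EReal.coe_ennreal_nonneg _)
  · rw [gibbsRate, if_neg hS]
    exact le_top

lemma continuous_pairing {φ : (k : Fin kmax) → (Fin ((k : ℕ) + 1) → V) → ℝ}
    (hφ : ∀ k, Continuous (φ k)) : Continuous fun S : MeasureFamily V kmax => pairing φ S :=
  continuous_finsetSum _ fun k _ =>
    (FiniteMeasure.continuous_integral_continuousMap (⟨φ k, hφ k⟩ : C(_, ℝ))).comp
      (continuous_apply k)

lemma lowerSemicontinuous_gibbsRate (hk : 0 < kmax) (hg : ∀ k, Continuous (g k))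
    (hμ : μ.mass ≠ 0) : LowerSemicontinuous (gibbsRate g μ : MeasureFamily V kmax → EReal) := by
  intro S a ha
  obtain ⟨r, har, hr⟩ := EReal.lt_iff_exists_real_btwn.1 ha
  obtain ⟨φ, hφ, hlt⟩ := exists_lt_legendre hk hg hμ hr
  have hc : Continuous fun S : MeasureFamily V kmax =>
      pairing φ S - (pressure (tilt g φ) μ - pressure g μ) :=
    (continuous_pairing hφ).sub continuous_const
  filter_upwards [hc.continuousAt.eventually_const_lt hlt] with S' hS'
  exact har.trans ((EReal.coe_lt_coe_iff.2 hS').trans_le (legendre_le_gibbsRate hk hg hμ S' hφ))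

lemma isCompact_mass_le (C : ℝ≥0) :
    IsCompact {S : MeasureFamily V kmax | ∀ k, (S k).mass ≤ C} := by
  have h := isCompact_univ_pi fun k : Fin kmax =>
    isCompact_setOfPred_finiteMeasure_le_of_compactSpace (Fin ((k : ℕ) + 1) → V) C
  convert h using 1
  ext S
  simp

lemma isCompact_gibbsRate_le (hk : 0 < kmax) (hg : ∀ k, Continuous (g k)) (hμ : μ.mass ≠ 0)
    (α : ℝ) : IsCompact {S : MeasureFamily V kmax | gibbsRate g μ S ≤ α} := by
  refine (isCompact_mass_le μ.mass).of_isClosed_subset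
    ((lowerSemicontinuous_gibbsRate hk hg hμ).isClosed_preimage _) fun S hS => ?_
  by_cases hS' : IsRouteingStrategy μ S
  · exact fun k => hS'.mass_le k
  · simp [gibbsRate, hS'] at hS

lemma gibbsRate_pos (hk : 0 < kmax) (hg : ∀ k, Continuous (g k)) (hμ : μ.mass ≠ 0)
    {S : MeasureFamily V kmax} (hS : S ≠ optimal g μ) : 0 < gibbsRate g μ S := by
  unfold gibbsRate
  split_ifs
  · rw [EReal.coe_ennreal_pos]
    exact pos_iff_ne_zero.2 fun h => hS (eq_optimal_of_klSum_eq_zero hk hg hμ h)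
  · exact EReal.zero_lt_top

lemma continuous_smul_test {φ : (k : Fin kmax) → (Fin ((k : ℕ) + 1) → V) → ℝ}
    (hφ : ∀ k, Continuous (φ k)) (t : ℝ) (k : Fin kmax) : Continuous fun y => t * φ k y :=
  continuous_const.mul (hφ k)

lemma continuous_pressure_smul (hk : 0 < kmax) (hg : ∀ k, Continuous (g k)) (hμ : μ.mass ≠ 0)
    {φ : (k : Fin kmax) → (Fin ((k : ℕ) + 1) → V) → ℝ} (hφ : ∀ k, Continuous (φ k)) :
    Continuous fun t : ℝ => pressure (tilt g fun k y => t * φ k y) μ := by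
  -- The lift places the real parameter in the universe of `V`, as `continuous_pressure_family`
  -- requires.
  have h := continuous_pressure_family hk (X := ULift.{u} ℝ) (L := fun _ => μ) continuous_const
    (fun _ => hμ) (G := fun t => tilt g fun k y => t.down * φ k y)
    (fun t k => continuous_tilt hg (continuous_smul_test hφ t.down) k) (fun k => by
      simp only [tilt]
      have h1 : Continuous fun p : ULift.{u} ℝ × (Fin ((k : ℕ) + 1) → V) => g k (μ, p.2) :=
        (hg k).comp (by fun_prop)
      have h2 : Continuous fun p : ULift.{u} ℝ × (Fin ((k : ℕ) + 1) → V) => φ k p.2 :=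
        (hφ k).comp (by fun_prop)
      have h3 : Continuous fun p : ULift.{u} ℝ × (Fin ((k : ℕ) + 1) → V) => p.1.down :=
        continuous_uliftDown.comp continuous_fst
      exact h1.sub (h3.mul h2))
  exact h.comp continuous_uliftUp

/-- The relative entropy of the minimizer for a tilted penalty. -/
lemma klSum_optimal_tilt (hk : 0 < kmax) (hg : ∀ k, Continuous (g k)) (hμ : μ.mass ≠ 0)
    {φ : (k : Fin kmax) → (Fin ((k : ℕ) + 1) → V) → ℝ} (hφ : ∀ k, Continuous (φ k)) :
    (klSum g μ (optimal (tilt g φ) μ) : EReal) = ((pairing φ (optimal (tilt g φ) μ) -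
      (pressure (tilt g φ) μ - pressure g μ) : ℝ) : EReal) := by
  rw [klSum_tilt hk hg hμ (isRouteingStrategy_optimal hk (continuous_tilt hg hφ) hμ) hφ,
    klSum_optimal hk (continuous_tilt hg hφ) hμ]
  simp

/-- Every strategy of finite relative entropy is approximated, in relative entropy, by minimizers of
tilted problems whose own relative entropy is not larger. -/
lemma exists_tilt_near (hk : 0 < kmax) (hg : ∀ k, Continuous (g k)) (hμ : μ.mass ≠ 0)
    {S : MeasureFamily V kmax} (hS : IsRouteingStrategy μ S) (hfin : klSum g μ S ≠ ∞)
    {ε : ℝ} (hε : 0 < ε) :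
    ∃ φ : (k : Fin kmax) → (Fin ((k : ℕ) + 1) → V) → ℝ, (∀ k, Continuous (φ k)) ∧
      klSum g μ (optimal (tilt g φ) μ) ≤ klSum g μ S ∧
      klSum (tilt g φ) μ S ≤ ENNReal.ofReal ε := by
  set I : ℝ := (klSum g μ S).toReal with hI
  have hIc : (klSum g μ S : EReal) = (I : EReal) := by
    rw [hI, ← coe_ennreal_ofReal_of_nonneg ENNReal.toReal_nonneg, ENNReal.ofReal_toReal hfin]
  have hlt : ((I - ε : ℝ) : EReal) < gibbsRate g μ S := by
    rw [gibbsRate, if_pos hS, hIc, EReal.coe_lt_coe_iff]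
    linarith
  obtain ⟨φ, hφ, hφI⟩ := exists_lt_legendre hk hg hμ hlt
  have hsm := continuous_smul_test hφ
  let p : ℝ → ℝ := fun t => pressure (tilt g fun k y => t * φ k y) μ - pressure g μ
  let h : ℝ → ℝ := fun t => t * pairing φ S - p t
  have hp : Continuous p := (continuous_pressure_smul hk hg hμ hφ).sub continuous_const
  have hh : Continuous h := (continuous_id.mul continuous_const).sub hp
  let O : ℝ → MeasureFamily V kmax := fun t => optimal (tilt g fun k y => t * φ k y) μ
  have hO : ∀ t, IsRouteingStrategy μ (O t) := fun t =>
    isRouteingStrategy_optimal hk (continuous_tilt hg (hsm t)) hμ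
  have hOkl : ∀ t, (klSum g μ (O t) : EReal) = ((t * pairing φ (O t) - p t : ℝ) : EReal) := by
    intro t
    rw [← pairing_const_mul]
    exact klSum_optimal_tilt hk hg hμ (hsm t)
  -- The subgradient inequality: `pairing φ (O s)` is a slope of the convex function `p` at `s`. It
  -- replaces differentiation of the pressure.
  have hge : ∀ s t, t * pairing φ (O s) - p t ≤ s * pairing φ (O s) - p s := by
    intro s t
    have h1 := legendre_le_gibbsRate hk hg hμ (O s) (hsm t)
    rw [gibbsRate, if_pos (hO s), hOkl s, EReal.coe_le_coe_iff, pairing_const_mul] at h1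
    exact h1
  have hSkl : ∀ t, (klSum g μ S : EReal) =
      (klSum (tilt g fun k y => t * φ k y) μ S : EReal) + ((h t : ℝ) : EReal) := by
    intro t
    rw [klSum_tilt hk hg hμ hS (hsm t), pairing_const_mul]
  have hone : I - ε < h 1 := by
    simpa [h, p] using hφI
  -- The near-optimal `φ` itself may lead to a minimizer of larger entropy than `S`. Rescaling it to
  -- a maximum of `h` on `[0, 1]` keeps `h > I - ε`. Just left of a positive maximizer `t`, `h s ≤ h
  -- t` and `hge` give `pairing φ (O s) ≤ pairing φ S`, so the entropy of `O s` is at most `h s ≤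
  -- I`.
  obtain ⟨t, ht, hmax⟩ := isCompact_Icc.exists_isMaxOn (Set.nonempty_Icc.2 zero_le_one)
    (hh.continuousOn (s := Set.Icc (0 : ℝ) 1))
  obtain ⟨s, hs0, hsI, hsO⟩ : ∃ s, 0 ≤ s ∧ I - ε < h s ∧
      s * pairing φ (O s) ≤ s * pairing φ S := by
    have htI : I - ε < h t := hone.trans_le (hmax (Set.right_mem_Icc.2 zero_le_one))
    rcases ht.1.eq_or_lt with h0 | h0
    · exact ⟨t, ht.1, htI, by simp [← h0]⟩
    · have hnear : ∀ᶠ s in 𝓝[<] t, I - ε < h s ∧ 0 < s :=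
        ((hh.tendsto t).eventually_const_lt htI |>.and (lt_mem_nhds h0)).filter_mono
          nhdsWithin_le_nhds
      obtain ⟨s, ⟨hsI, hs0⟩, hst⟩ := (hnear.and self_mem_nhdsWithin).exists
      have hst : s < t := hst
      refine ⟨s, hs0.le, hsI, mul_le_mul_of_nonneg_left ?_ hs0.le⟩
      have h2 : h s ≤ h t := hmax ⟨hs0.le, hst.le.trans ht.2⟩
      have h3 := hge s t
      have h4 : (t - s) * pairing φ (O s) ≤ (t - s) * pairing φ S := by
        simp only [h] at h2
        nlinarith
      exact le_of_mul_le_mul_left h4 (sub_pos.2 hst)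
  have hle : h s ≤ I := by
    have := legendre_le_gibbsRate hk hg hμ S (hsm s)
    rw [gibbsRate, if_pos hS, hIc, EReal.coe_le_coe_iff, pairing_const_mul] at this
    exact this
  refine ⟨fun k y => s * φ k y, hsm s, ?_, ?_⟩
  · rw [← EReal.coe_ennreal_le_coe_ennreal_iff, hIc]
    change (klSum g μ (O s) : EReal) ≤ _
    rw [hOkl s, EReal.coe_le_coe_iff]
    simp only [h] at hle
    linarith
  · have h5 := hSkl s
    rw [hIc] at h5
    rw [← EReal.coe_ennreal_le_coe_ennreal_iff, coe_ennreal_ofReal_of_nonneg hε.le]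
    by_contra hcon
    have h6 : ((ε + h s : ℝ) : EReal) ≤ (I : EReal) := by
      rw [h5, EReal.coe_add]
      exact add_le_add_left (not_le.1 hcon).le _
    rw [EReal.coe_le_coe_iff] at h6
    linarith

/-- Smallness of the relative entropy controls the integrals of a bounded function. -/
lemma abs_integral_sub_le_of_klDiv_le {Y : Type*} [MeasurableSpace Y] {ν ρ : Measure Y}
    [IsFiniteMeasure ν] [IsFiniteMeasure ρ] {u : ℝ} (hu : 0 < u)
    (hkl : klDiv ν ρ ≤ ENNReal.ofReal (u ^ 2)) {h : Y → ℝ} (hh : Measurable h) {M : ℝ}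
    (hM : ∀ y, |h y| ≤ M) (huM : u * M ≤ 1) :
    |∫ y, h y ∂ν - ∫ y, h y ∂ρ| ≤ u * (1 + M ^ 2 * ρ.real Set.univ) := by
  -- Entropy duality is applied to `±u h` with `e^x - 1 ≤ x + x²` for `|x| ≤ 1`. Both errors are of
  -- order `u²`, and one factor `u` is divided out at the end.
  have key : ∀ t : ℝ, |t| = u → t * (∫ y, h y ∂ν - ∫ y, h y ∂ρ) ≤
      u * (u * (1 + M ^ 2 * ρ.real Set.univ)) := by
    intro t ht
    have hM' : ∀ y, |t * h y| ≤ u * M := fun y => by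
      rw [abs_mul, ht]
      exact mul_le_mul_of_nonneg_left (hM y) hu.le
    have h1 := (entropyGap_le_klDiv (ν := ν) (ρ := ρ) (hh.const_mul t) hM').trans
      (EReal.coe_ennreal_le_coe_ennreal_iff.2 hkl)
    rw [coe_ennreal_ofReal_of_nonneg (by positivity), EReal.coe_le_coe_iff, entropyGap,
      integral_const_mul] at h1
    have h2 : ∫ y, (Real.exp (t * h y) - 1) ∂ρ ≤ ∫ y, (t * h y + (u * M) ^ 2) ∂ρ := by
      refine integral_mono (integrable_exp_sub_one_of_abs_le (hh.const_mul t) hM')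
        ((integrable_of_abs_le (hh.const_mul t) hM').add (integrable_const _)) fun y => ?_
      have h3 := (le_abs_self _).trans (Real.abs_exp_sub_one_sub_id_le ((hM' y).trans huM))
      have h4 : (t * h y) ^ 2 ≤ (u * M) ^ 2 := sq_le_sq' (abs_le.1 (hM' y)).1 (abs_le.1 (hM' y)).2
      dsimp only
      linarith
    rw [integral_add (integrable_of_abs_le (hh.const_mul t) hM') (integrable_const _),
      integral_const_mul, integral_const, smul_eq_mul] at h2
    nlinarith
  refine abs_le.2 ⟨?_, ?_⟩
  · have := key (-u) (by rw [abs_neg, abs_of_pos hu])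
    have h5 : u * -(∫ y, h y ∂ν - ∫ y, h y ∂ρ) ≤ u * (u * (1 + M ^ 2 * ρ.real Set.univ)) := by
      linarith
    linarith [le_of_mul_le_mul_left h5 hu]
  · exact le_of_mul_le_mul_left (key u (abs_of_pos hu)) hu

lemma exists_tilt_mem_open (hk : 0 < kmax) (hg : ∀ k, Continuous (g k)) (hμ : μ.mass ≠ 0)
    {S : MeasureFamily V kmax} (hS : IsRouteingStrategy μ S) (hfin : klSum g μ S ≠ ∞)
    {G : Set (MeasureFamily V kmax)} (hG : G ∈ 𝓝 S) :
    ∃ φ : (k : Fin kmax) → (Fin ((k : ℕ) + 1) → V) → ℝ, (∀ k, Continuous (φ k)) ∧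
      optimal (tilt g φ) μ ∈ G ∧ klSum g μ (optimal (tilt g φ) μ) ≤ klSum g μ S := by
  let u : ℕ → ℝ := fun j => 1 / ((j : ℝ) + 1)
  have hu : ∀ j, 0 < u j := fun j => by positivity
  have hu0 : Tendsto u atTop (𝓝 0) := tendsto_one_div_add_atTop_nhds_zero_nat
  choose φ hφ hle hnear using fun j => exists_tilt_near hk hg hμ hS hfin (pow_pos (hu j) 2)
  have htend : Tendsto (fun j => optimal (tilt g (φ j)) μ) atTop (𝓝 S) := by
    refine tendsto_pi_nhds.2 fun k => FiniteMeasure.tendsto_of_forall_integral_tendsto fun h => ?_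
    obtain ⟨M, hM⟩ := exists_abs_le_of_continuous h.continuous
    rw [tendsto_iff_dist_tendsto_zero]
    have hsmall : ∀ᶠ j in atTop, u j * M < 1 := by
      have := hu0.mul_const M
      rw [zero_mul] at this
      exact this.eventually_lt_const one_pos
    have hb : Tendsto (fun j => u j * (1 + M ^ 2 * μ.mass)) atTop (𝓝 0) := by
      simpa using hu0.mul_const (1 + M ^ 2 * (μ.mass : ℝ))
    refine squeeze_zero' (Eventually.of_forall fun j => dist_nonneg) ?_ hb
    filter_upwards [hsmall] with j hj
    have hgt := continuous_tilt hg (hφ j)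
    rw [dist_comm, Real.dist_eq]
    have hklk : klDiv (S k : Measure (Fin ((k : ℕ) + 1) → V))
        (optimal (tilt g (φ j)) μ k : Measure (Fin ((k : ℕ) + 1) → V)) ≤
          ENNReal.ofReal (u j ^ 2) := by
      rw [coe_optimal hk hgt hμ]
      refine le_trans ?_ (hnear j)
      exact Finset.single_le_sum (f := fun k : Fin kmax => klDiv
        (S k : Measure (Fin ((k : ℕ) + 1) → V)) (optimalMeasure (tilt g (φ j)) μ k))
        (fun _ _ => zero_le) (Finset.mem_univ k)
    refine (abs_integral_sub_le_of_klDiv_le (hu j) hklk h.continuous.measurable hM hj.le).trans ?_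
    have hm : ((optimal (tilt g (φ j)) μ k : Measure (Fin ((k : ℕ) + 1) → V))).real Set.univ ≤
        μ.mass := by
      have := (isRouteingStrategy_optimal hk hgt hμ).mass_le k
      rw [← NNReal.coe_le_coe] at this
      exact this
    have := (hu j).le
    gcongr
  obtain ⟨j, hj⟩ := (htend.eventually hG).exists
  exact ⟨φ j, hφ j, hj, hle j⟩

end Rate

/-! ### Asymptotics of the Gibbs distributions along convergent empirical measures -/

section Asymptotics

universe u

variable {V : Type u} [TopologicalSpace V] [CompactSpace V] [SecondCountableTopology V]
  [MeasurableSpace V] [BorelSpace V] [TopologicalSpace.MetrizableSpace V] {kmax : ℕ}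
  {g : Penalty V kmax} {μ : FiniteMeasure V} {n : ℝ≥0 → ℕ} {x : ∀ lam, Fin (n lam) → V}

lemma tendsto_coe_atTop : Tendsto (fun lam : ℝ≥0 => (lam : ℝ)) atTop atTop :=
  NNReal.tendsto_coe_atTop.2 tendsto_id

lemma eventually_count (hμ : μ.mass ≠ 0)
    (hx : Tendsto (fun lam => userEmpirical lam (x lam)) atTop (𝓝 μ)) :
    ∀ᶠ lam : ℝ≥0 in atTop, lam ≠ 0 ∧ n lam ≠ 0 ∧ (lam : ℝ)⁻¹ * n lam ≤ (μ.mass + 1 : ℝ≥0) := by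
  have hm : Tendsto (fun lam => ((userEmpirical lam (x lam)).mass : ℝ)) atTop (𝓝 (μ.mass : ℝ)) :=
    (NNReal.continuous_coe.tendsto _).comp hx.mass
  simp_rw [mass_userEmpirical] at hm
  have hpos : (0 : ℝ) < μ.mass := by exact_mod_cast pos_iff_ne_zero.2 hμ
  filter_upwards [eventually_gt_atTop 0, hm.eventually_const_lt hpos,
    hm.eventually_lt_const (lt_add_one (μ.mass : ℝ))] with lam h0 h1 h2
  refine ⟨h0.ne', fun h => ?_, ?_⟩
  · simp [h] at h1
  · push_cast
    exact h2.le

lemma eventually_partitionFunction (hk : 0 < kmax) (hg : ∀ k, Continuous (g k)) (hμ : μ.mass ≠ 0)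
    (hx : Tendsto (fun lam => userEmpirical lam (x lam)) atTop (𝓝 μ)) :
    ∀ᶠ lam : ℝ≥0 in atTop, partitionFunction g 1 lam (x lam) =
      Real.exp (lam * pressure g (userEmpirical lam (x lam))) := by
  filter_upwards [eventually_count hμ hx] with lam h
  exact partitionFunction_eq_exp_pressure hk hg h.1 h.2.1 (x lam)

lemma tendsto_log_partitionFunction (hk : 0 < kmax) (hg : ∀ k, Continuous (g k))
    (hμ : μ.mass ≠ 0) (hx : Tendsto (fun lam => userEmpirical lam (x lam)) atTop (𝓝 μ)) :
    Tendsto (fun lam : ℝ≥0 => (lam : ℝ)⁻¹ * Real.log (partitionFunction g 1 lam (x lam))) atTop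
      (𝓝 (pressure g μ)) := by
  refine ((tendsto_pressure hk hg hμ).comp hx).congr' ?_
  filter_upwards [eventually_partitionFunction hk hg hμ hx, eventually_gt_atTop 0] with lam h h0
  have : (lam : ℝ) ≠ 0 := NNReal.coe_ne_zero.2 h0.ne'
  rw [h, Real.log_exp, inv_mul_cancel_left₀ this]
  rfl

/-- Local exponential upper bound. -/
lemma exists_nhds_gibbsProb_le (hk : 0 < kmax) (hg : ∀ k, Continuous (g k)) (hμ : μ.mass ≠ 0)
    (hx : Tendsto (fun lam => userEmpirical lam (x lam)) atTop (𝓝 μ))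
    {S : MeasureFamily V kmax} {a : ℝ} (ha : (a : EReal) < gibbsRate g μ S) :
    ∃ U ∈ 𝓝 S, ∀ᶠ lam : ℝ≥0 in atTop, gibbsProb g 1 lam (x lam) U ≤ Real.exp (-(lam * a)) := by
  obtain ⟨φ, hφ, hlt⟩ := exists_lt_legendre hk hg hμ ha
  have hgt := continuous_tilt hg hφ
  set D := pressure (tilt g φ) μ - pressure g μ with hD
  -- The neighbourhood is an open half-space. Chebyshev gives the exponent `D - c < -a`, and the
  -- slack absorbs the error in the convergence of the pressures.
  obtain ⟨c, hc1, hc2⟩ := exists_between (show a + D < pairing φ S by linarith)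
  refine ⟨{S' | c < pairing φ S'}, (continuous_pairing hφ).continuousAt.eventually_const_lt hc2, ?_⟩
  have hconv : Tendsto (fun lam => pressure (tilt g φ) (userEmpirical lam (x lam)) -
      pressure g (userEmpirical lam (x lam))) atTop (𝓝 D) :=
    ((tendsto_pressure hk hgt hμ).comp hx).sub ((tendsto_pressure hk hg hμ).comp hx)
  filter_upwards [eventually_count hμ hx, eventually_partitionFunction hk hg hμ hx,
    eventually_partitionFunction hk hgt hμ hx,
    hconv.eventually_lt_const (show D < c - a by linarith)] with lam h1 h2 h3 h4
  refine (gibbsProb_le_of_tilt hk g (fun k => (hφ k).measurable) h1.1 (x lam) (E' := Set.univ)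
    (fun _ _ => Set.mem_univ _) (c := c) fun S' hS' => le_of_lt hS').trans ?_
  rw [gibbsProb_univ hk, mul_one, h2, h3, ← Real.exp_sub, ← Real.exp_add, Real.exp_le_exp]
  have := mul_le_mul_of_nonneg_left h4.le lam.coe_nonneg
  linarith

/-- Each component of a realized `Σ_λ` has mass at most `m / λ`, so restricting to the compact set
of bounded masses loses nothing. This plays the role of exponential tightness. -/
lemma gibbsProb_le_inter_mass (hk : 0 < kmax) {C : ℝ≥0} {lam : ℝ≥0} {m : ℕ} {y : Fin m → V}
    (h : (lam : ℝ)⁻¹ * m ≤ C) (E : Set (MeasureFamily V kmax)) :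
    gibbsProb g 1 lam y E ≤ gibbsProb g 1 lam y ({S | ∀ k, (S k).mass ≤ C} ∩ E) := by
  refine gibbsProb_mono hk g 1 lam y fun s hs => ⟨fun k => ?_, hs⟩
  rw [← NNReal.coe_le_coe]
  exact (mass_trajEmpirical_le lam y s k).trans h

/-- The exponential upper bound for closed sets. -/
lemma exists_gibbsProb_le_of_isClosed (hk : 0 < kmax) (hg : ∀ k, Continuous (g k))
    (hμ : μ.mass ≠ 0) (hx : Tendsto (fun lam => userEmpirical lam (x lam)) atTop (𝓝 μ))
    {F : Set (MeasureFamily V kmax)} (hF : IsClosed F) {a : ℝ}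
    (ha : ∀ S ∈ F, (a : EReal) < gibbsRate g μ S) :
    ∃ C : ℝ, ∀ᶠ lam : ℝ≥0 in atTop, gibbsProb g 1 lam (x lam) F ≤ C * Real.exp (-(lam * a)) := by
  have hcomp : IsCompact ({S : MeasureFamily V kmax | ∀ k, (S k).mass ≤ μ.mass + 1} ∩ F) :=
    (isCompact_mass_le (μ.mass + 1)).inter_right hF
  obtain ⟨C, hC⟩ : ∃ C : ℝ, ∀ᶠ lam : ℝ≥0 in atTop, gibbsProb g 1 lam (x lam)
      ({S : MeasureFamily V kmax | ∀ k, (S k).mass ≤ μ.mass + 1} ∩ F) ≤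
        C * Real.exp (-(lam * a)) := by
    -- Compact induction performs the finite covering; the constants `C` add up over the cover.
    refine hcomp.induction_on (p := fun A => ∃ C : ℝ, ∀ᶠ lam : ℝ≥0 in atTop,
      gibbsProb g 1 lam (x lam) A ≤ C * Real.exp (-(lam * a))) ?_ ?_ ?_ ?_
    · exact ⟨0, Eventually.of_forall fun lam => by simp [gibbsProb]⟩
    · rintro A B hAB ⟨C, hC⟩
      exact ⟨C, hC.mono fun lam h => (gibbsProb_mono hk g 1 lam _ fun _ hs => hAB hs).trans h⟩
    · rintro A B ⟨C, hC⟩ ⟨C', hC'⟩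
      refine ⟨C + C', ?_⟩
      filter_upwards [hC, hC'] with lam h h'
      rw [add_mul]
      exact (gibbsProb_union_le hk g 1 lam _ A B).trans (add_le_add h h')
    · rintro S ⟨-, hS⟩
      obtain ⟨U, hU, h⟩ := exists_nhds_gibbsProb_le hk hg hμ hx (ha S hS)
      exact ⟨U, mem_nhdsWithin_of_mem_nhds hU, 1, by simpa using h⟩
  refine ⟨C, ?_⟩
  filter_upwards [hC, eventually_count hμ hx] with lam h h'
  exact (gibbsProb_le_inter_mass hk h'.2.2 F).trans h

/-- The empirical measures converge in probability to the minimizer. -/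
theorem tendsto_gibbsProb_compl (hk : 0 < kmax) (hg : ∀ k, Continuous (g k)) (hμ : μ.mass ≠ 0)
    (hx : Tendsto (fun lam => userEmpirical lam (x lam)) atTop (𝓝 μ))
    {U : Set (MeasureFamily V kmax)} (hU : U ∈ 𝓝 (optimal g μ)) :
    Tendsto (fun lam => gibbsProb g 1 lam (x lam) Uᶜ) atTop (𝓝 0) := by
  set F : Set (MeasureFamily V kmax) := (interior U)ᶜ with hFdef
  have hF : IsClosed F := isOpen_interior.isClosed_compl
  have hcomp : IsCompact ({S : MeasureFamily V kmax | ∀ k, (S k).mass ≤ μ.mass + 1} ∩ F) :=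
    (isCompact_mass_le (μ.mass + 1)).inter_right hF
  have hlim : Tendsto (fun lam => gibbsProb g 1 lam (x lam)
      ({S : MeasureFamily V kmax | ∀ k, (S k).mass ≤ μ.mass + 1} ∩ F)) atTop (𝓝 0) := by
    refine hcomp.induction_on (p := fun A => Tendsto (fun lam => gibbsProb g 1 lam (x lam) A)
      atTop (𝓝 0)) ?_ ?_ ?_ ?_
    · simp [gibbsProb]
    · intro A B hAB hB
      exact squeeze_zero (fun lam => gibbsProb_nonneg hk g 1 lam _ A)
        (fun lam => gibbsProb_mono hk g 1 lam _ fun _ hs => hAB hs) hB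
    · intro A B hA hB
      have := hA.add hB
      rw [add_zero] at this
      exact squeeze_zero (fun lam => gibbsProb_nonneg hk g 1 lam _ _)
        (fun lam => gibbsProb_union_le hk g 1 lam _ A B) this
    · rintro S ⟨-, hS⟩
      have hne : S ≠ optimal g μ := by
        rintro rfl
        exact hS (mem_interior_iff_mem_nhds.2 hU)
      obtain ⟨a, ha0, ha⟩ := EReal.lt_iff_exists_real_btwn.1 (gibbsRate_pos hk hg hμ hne)
      have ha0 : 0 < a := by exact_mod_cast ha0
      -- Away from the minimizer the rate is positive, so each point has a neighbourhood of
      -- exponentially small probability.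
      obtain ⟨W, hW, h⟩ := exists_nhds_gibbsProb_le hk hg hμ hx ha
      refine ⟨W, mem_nhdsWithin_of_mem_nhds hW, ?_⟩
      exact squeeze_zero' (Eventually.of_forall fun lam => gibbsProb_nonneg hk g 1 lam _ _) h
        (Real.tendsto_exp_neg_atTop_nhds_zero.comp (tendsto_coe_atTop.atTop_mul_const ha0))
  refine squeeze_zero' (Eventually.of_forall fun lam => gibbsProb_nonneg hk g 1 lam _ _) ?_ hlim
  filter_upwards [eventually_count hμ hx] with lam h
  refine le_trans ?_ (gibbsProb_le_inter_mass hk h.2.2 F)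
  exact gibbsProb_mono hk g 1 lam _ fun s hs hsU => hs (interior_subset hsU)

/-- Exponential lower bound at the minimizers of tilted problems. -/
lemma eventually_le_gibbsProb (hk : 0 < kmax) (hg : ∀ k, Continuous (g k)) (hμ : μ.mass ≠ 0)
    (hx : Tendsto (fun lam => userEmpirical lam (x lam)) atTop (𝓝 μ))
    {φ : (k : Fin kmax) → (Fin ((k : ℕ) + 1) → V) → ℝ} (hφ : ∀ k, Continuous (φ k))
    {G : Set (MeasureFamily V kmax)} (hG : G ∈ 𝓝 (optimal (tilt g φ) μ)) {b : ℝ}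
    (hb : (klSum g μ (optimal (tilt g φ) μ) : EReal) < b) :
    ∀ᶠ lam : ℝ≥0 in atTop, Real.exp (-(lam * b)) ≤ gibbsProb g 1 lam (x lam) G := by
  have hgt := continuous_tilt hg hφ
  rw [klSum_optimal_tilt hk hg hμ hφ, EReal.coe_lt_coe_iff] at hb
  set D := pressure (tilt g φ) μ - pressure g μ with hD
  set O := optimal (tilt g φ) μ with hO
  -- One third of the gap each pays for the fluctuation of `pairing φ` on `E`, the convergence of
  -- the pressures and the factor `1 / 2`.
  set δ := (b - (pairing φ O - D)) / 3 with hδ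
  have hδ0 : 0 < δ := by rw [hδ]; linarith
  set E : Set (MeasureFamily V kmax) := G ∩ {S | pairing φ S < pairing φ O + δ} with hE
  have hEmem : E ∈ 𝓝 O := inter_mem hG
    ((continuous_pairing hφ).continuousAt.eventually_lt_const (by linarith))
  have hconv : Tendsto (fun lam => pressure (tilt g φ) (userEmpirical lam (x lam)) -
      pressure g (userEmpirical lam (x lam))) atTop (𝓝 D) :=
    ((tendsto_pressure hk hgt hμ).comp hx).sub ((tendsto_pressure hk hg hμ).comp hx)
  have hexp : Tendsto (fun lam : ℝ≥0 => Real.exp (-(lam * δ))) atTop (𝓝 0) :=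
    Real.tendsto_exp_neg_atTop_nhds_zero.comp (tendsto_coe_atTop.atTop_mul_const hδ0)
  filter_upwards [eventually_count hμ hx, eventually_partitionFunction hk hg hμ hx,
    eventually_partitionFunction hk hgt hμ hx,
    hconv.eventually_const_lt (show D - δ < D by linarith),
    (tendsto_gibbsProb_compl hk hgt hμ hx hEmem).eventually_lt_const
      (show (0 : ℝ) < 1 / 2 by norm_num),
    hexp.eventually_lt_const (show (0 : ℝ) < 1 / 2 by norm_num)] with lam h1 h2 h3 h4 h5 h6
  have h7 : 1 / 2 ≤ gibbsProb (tilt g φ) 1 lam (x lam) E := by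
    have := gibbsProb_union_le hk (tilt g φ) 1 lam (x lam) E Eᶜ
    rw [Set.union_compl_self, gibbsProb_univ hk] at this
    linarith
  -- Tilting back by `-φ` lets the upper comparison `gibbsProb_le_of_tilt`, started from the tilted
  -- measure, bound the original probability from below.
  have hback : tilt (tilt g φ) (fun k y => -φ k y) = g := by
    ext k p
    simp [tilt]
  have hneg : ∀ S, pairing (fun k y => -φ k y) S = -pairing φ S := fun S => by
    simp [pairing, integral_neg]
  have h8 := gibbsProb_le_of_tilt hk (tilt g φ) (φ := fun k y => -φ k y)
    (fun k => (hφ k).measurable.neg) h1.1 (x lam) (E := E) (E' := G) (fun s hs => hs.1)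
    (c := -(pairing φ O + δ)) (fun S hS => by rw [hneg]; exact neg_le_neg (le_of_lt hS.2))
  rw [hback, h2, h3, ← Real.exp_sub, ← Real.exp_add] at h8
  set Q := gibbsProb g 1 lam (x lam) G
  set r := -(lam : ℝ) * -(pairing φ O + δ) + (lam * pressure g (userEmpirical lam (x lam)) -
    lam * pressure (tilt g φ) (userEmpirical lam (x lam))) with hr
  have hr' : r ≤ lam * (b - δ) := by
    have := mul_le_mul_of_nonneg_left h4.le lam.coe_nonneg
    have hb' : b = pairing φ O - D + 3 * δ := by rw [hδ]; ring
    rw [hr, hb']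
    linarith
  calc Real.exp (-(lam * b)) = Real.exp (-(lam * (b - δ))) * Real.exp (-(lam * δ)) := by
        rw [← Real.exp_add]; ring_nf
    _ ≤ Real.exp (-r) * (Real.exp r * Q) := by
        gcongr
        exact h6.le.trans (h7.trans h8)
    _ = Q := by rw [← mul_assoc, ← Real.exp_add]; simp

lemma log_ofReal_mul_le {lam : ℝ≥0} (hlam : lam ≠ 0) {q b : ℝ} (h : q ≤ Real.exp (lam * b)) :
    (((lam : ℝ)⁻¹ : ℝ) : EReal) * ENNReal.log (ENNReal.ofReal q) ≤ (b : EReal) := by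
  have hl : (lam : ℝ) ≠ 0 := NNReal.coe_ne_zero.2 hlam
  have h1 : ENNReal.log (ENNReal.ofReal q) ≤ ((lam * b : ℝ) : EReal) := by
    rw [← Real.log_exp (lam * b), ← ENNReal.log_ofReal_of_pos (Real.exp_pos _)]
    exact ENNReal.log_le_log (ENNReal.ofReal_le_ofReal h)
  calc _ ≤ (((lam : ℝ)⁻¹ : ℝ) : EReal) * ((lam * b : ℝ) : EReal) :=
        mul_le_mul_of_nonneg_left h1 (by exact_mod_cast inv_nonneg.2 lam.coe_nonneg)
    _ = _ := by rw [← EReal.coe_mul, inv_mul_cancel_left₀ hl]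

lemma le_log_ofReal_mul {lam : ℝ≥0} (hlam : lam ≠ 0) {q b : ℝ} (h : Real.exp (lam * b) ≤ q) :
    (b : EReal) ≤ (((lam : ℝ)⁻¹ : ℝ) : EReal) * ENNReal.log (ENNReal.ofReal q) := by
  have hl : (lam : ℝ) ≠ 0 := NNReal.coe_ne_zero.2 hlam
  have h1 : ((lam * b : ℝ) : EReal) ≤ ENNReal.log (ENNReal.ofReal q) := by
    rw [← Real.log_exp (lam * b), ← ENNReal.log_ofReal_of_pos (Real.exp_pos _)]
    exact ENNReal.log_le_log (ENNReal.ofReal_le_ofReal h)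
  calc (b : EReal) = (((lam : ℝ)⁻¹ : ℝ) : EReal) * ((lam * b : ℝ) : EReal) := by
        rw [← EReal.coe_mul, inv_mul_cancel_left₀ hl]
    _ ≤ _ := mul_le_mul_of_nonneg_left h1 (by exact_mod_cast inv_nonneg.2 lam.coe_nonneg)

/-- The large deviation principle for the Gibbs distribution with penalty `g`, along empirical
measures of users that converge to `μ`. -/
theorem isLDP_gibbsRate (hk : 0 < kmax) (hg : ∀ k, Continuous (g k)) (hμ : μ.mass ≠ 0)
    (hx : Tendsto (fun lam => userEmpirical lam (x lam)) atTop (𝓝 μ)) :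
    IsLDP (fun lam E => gibbsProb g 1 lam (x lam) E) (gibbsRate g μ) where
  nonneg := gibbsRate_nonneg
  lowerSemicontinuous := lowerSemicontinuous_gibbsRate hk hg hμ
  upper F hF := by
    refine EReal.le_of_forall_lt_iff_le.1 fun r hr => ?_
    have hr' : ((-r : ℝ) : EReal) < ⨅ S ∈ F, gibbsRate g μ S := by
      rw [EReal.coe_neg]
      exact EReal.neg_lt_of_neg_lt hr
    obtain ⟨a, ha, ha'⟩ := EReal.lt_iff_exists_real_btwn.1 hr'
    have ha : -r < a := EReal.coe_lt_coe_iff.1 ha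
    obtain ⟨C, hC⟩ := exists_gibbsProb_le_of_isClosed hk hg hμ hx hF
      fun S hS => ha'.trans_le (iInf₂_le S hS)
    -- Since `-r < a`, the exponential margin `e^{λ(a + r)}` eventually exceeds the covering
    -- constant `C`.
    have hexp : Tendsto (fun lam : ℝ≥0 => Real.exp (lam * (a + r))) atTop atTop :=
      Real.tendsto_exp_atTop.comp (tendsto_coe_atTop.atTop_mul_const (by linarith))
    refine limsup_le_of_le (h := ?_)
    filter_upwards [hC, hexp.eventually_ge_atTop C, eventually_gt_atTop 0] with lam h1 h2 h3
    refine log_ofReal_mul_le h3.ne' (h1.trans ?_)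
    calc C * Real.exp (-(lam * a)) ≤ Real.exp (lam * (a + r)) * Real.exp (-(lam * a)) := by gcongr
      _ = Real.exp (lam * r) := by rw [← Real.exp_add]; ring_nf
  lower G hG := by
    refine le_of_forall_lt fun c hc => ?_
    obtain ⟨r, hcr, hr⟩ := EReal.lt_iff_exists_real_btwn.1 hc
    have hr' : ⨅ S ∈ G, gibbsRate g μ S < ((-r : ℝ) : EReal) := by
      rw [EReal.coe_neg]
      exact EReal.lt_neg_of_lt_neg hr
    obtain ⟨S, hSG, hSr⟩ : ∃ S ∈ G, gibbsRate g μ S < ((-r : ℝ) : EReal) := by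
      simpa [iInf_lt_iff] using hr'
    by_cases hS : IsRouteingStrategy μ S
    · rw [gibbsRate, if_pos hS] at hSr
      have hfin : klSum g μ S ≠ ∞ := fun h => by simp [h] at hSr
      obtain ⟨φ, hφ, hO, hle⟩ := exists_tilt_mem_open hk hg hμ hS hfin (hG.mem_nhds hSG)
      have hb : (klSum g μ (optimal (tilt g φ) μ) : EReal) < ((-r : ℝ) : EReal) :=
        (EReal.coe_ennreal_le_coe_ennreal_iff.2 hle).trans_lt hSr
      refine hcr.trans_le (le_liminf_of_le (h := ?_))
      filter_upwards [eventually_le_gibbsProb hk hg hμ hx hφ (hG.mem_nhds hO) hb,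
        eventually_gt_atTop 0] with lam h1 h2
      exact le_log_ofReal_mul h2.ne' (by simpa using h1)
    · rw [gibbsRate, if_neg hS] at hSr
      exact absurd hSr not_top_lt

end Asymptotics

/-! ### Almost sure convergence of the user measures -/

section Users

lemma hasSum_poisson_mean (r : ℝ≥0) :
    HasSum (fun n : ℕ => Real.exp (-r) * (r : ℝ) ^ n / (n.factorial : ℝ) * n) r := by
  rw [← hasSum_nat_add_iff' 1]
  have h := (hasSum_one_poissonMeasure r).mul_left (r : ℝ)
  simp only [Finset.sum_range_one, Nat.cast_zero, mul_zero, sub_zero]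
  rw [mul_one] at h
  refine h.congr_fun fun n => ?_
  rw [Nat.factorial_succ]
  push_cast
  have : ((n.factorial : ℕ) : ℝ) ≠ 0 := by exact_mod_cast n.factorial_ne_zero
  field_simp
  ring

lemma integrable_cast_poissonMeasure (r : ℝ≥0) :
    Integrable (fun n : ℕ => (n : ℝ)) (poissonMeasure r) := by
  rw [integrable_poissonMeasure_iff]
  simpa using (hasSum_poisson_mean r).summable

lemma integral_cast_poissonMeasure (r : ℝ≥0) : ∫ n : ℕ, (n : ℝ) ∂(poissonMeasure r) = r := by
  rw [integral_poissonMeasure]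
  simpa using (hasSum_poisson_mean r).tsum_eq

variable {V : Type*} [MeasurableSpace V] {Ω : Type*} [MeasurableSpace Ω]
  {μ : FiniteMeasure V} {P : Measure Ω} [IsProbabilityMeasure P] {N : ℝ≥0 → Ω → ℕ} {X : ℕ → Ω → V}

/-- The strong law for the independent Poisson increments over unit intervals. The truncated
differences telescope because paths are monotone and start at `0`. -/
lemma IsUserProcess.tendsto_count_nat (h : IsUserProcess μ P N X) :
    ∀ᵐ ω ∂P, Tendsto (fun n : ℕ => (N n ω : ℝ) / n) atTop (𝓝 (μ.mass : ℝ)) := by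
  let Y : ℕ → Ω → ℕ := fun i ω => N ((i + 1 : ℕ) : ℝ≥0) ω - N (i : ℝ≥0) ω
  have hYm : ∀ i, Measurable (Y i) := fun i => (h.measurable_count _).sub (h.measurable_count _)
  have hlaw : ∀ i, P.map (Y i) = poissonMeasure μ.mass := by
    intro i
    have := h.count_increment_law (i : ℝ≥0) ((i + 1 : ℕ) : ℝ≥0) (by exact_mod_cast i.le_succ)
    rw [show ((i + 1 : ℕ) : ℝ≥0) - (i : ℝ≥0) = 1 by push_cast; exact add_tsub_cancel_left _ _,
      mul_one] at this
    exact this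
  have hcast : Measurable fun n : ℕ => (n : ℝ) := measurable_from_nat
  have hind : iIndepFun Y P := h.count_indep_increments.nat Nat.mono_cast
  have hint : Integrable (fun ω => (Y 0 ω : ℝ)) P := by
    have := integrable_cast_poissonMeasure μ.mass
    rw [← hlaw 0] at this
    exact (integrable_map_measure hcast.aestronglyMeasurable (hYm 0).aemeasurable).1 this
  have hmean : ∫ ω, (Y 0 ω : ℝ) ∂P = μ.mass := by
    rw [← integral_cast_poissonMeasure μ.mass, ← hlaw 0,
      integral_map (hYm 0).aemeasurable hcast.aestronglyMeasurable]
  have hslln := strong_law_ae_real (fun i ω => (Y i ω : ℝ)) hint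
    (fun i j hij => (hind.indepFun hij).comp hcast hcast)
    (fun i => (IdentDistrib.mk (hYm i).aemeasurable (hYm 0).aemeasurable
      ((hlaw i).trans (hlaw 0).symm)).comp hcast)
  rw [hmean] at hslln
  filter_upwards [hslln, h.count_zero, h.count_paths] with ω h1 h2 h3
  refine h1.congr fun n => ?_
  have hmono : Monotone fun i : ℕ => N (i : ℝ≥0) ω := h3.1.comp Nat.mono_cast
  rw [← Nat.cast_sum]
  simp only [Y]
  rw [Finset.sum_range_tsub hmono, Nat.cast_zero, h2, Nat.sub_zero]

/-- Monotone paths sandwich `N t` between its values at the floor and the ceiling of `t`. -/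
lemma IsUserProcess.tendsto_count (h : IsUserProcess μ P N X) :
    ∀ᵐ ω ∂P, Tendsto (fun t : ℝ≥0 => (t : ℝ)⁻¹ * N t ω) atTop (𝓝 (μ.mass : ℝ)) := by
  filter_upwards [h.tendsto_count_nat, h.count_paths] with ω h1 h2
  have hcoe : Tendsto (fun t : ℝ≥0 => (t : ℝ)) atTop atTop := tendsto_coe_atTop
  have hlow : Tendsto (fun t : ℝ≥0 => (N (⌊(t : ℝ)⌋₊ : ℝ≥0) ω : ℝ) / (⌊(t : ℝ)⌋₊ : ℕ) *
      ((⌊(t : ℝ)⌋₊ : ℕ) / (t : ℝ))) atTop (𝓝 (μ.mass : ℝ)) := by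
    have := (h1.comp (tendsto_nat_floor_atTop.comp hcoe)).mul
      ((tendsto_nat_floor_div_atTop (R := ℝ)).comp hcoe)
    simpa using this
  have hup : Tendsto (fun t : ℝ≥0 => (N (⌈(t : ℝ)⌉₊ : ℝ≥0) ω : ℝ) / (⌈(t : ℝ)⌉₊ : ℕ) *
      ((⌈(t : ℝ)⌉₊ : ℕ) / (t : ℝ))) atTop (𝓝 (μ.mass : ℝ)) := by
    have := (h1.comp (tendsto_nat_ceil_atTop.comp hcoe)).mul
      ((tendsto_nat_ceil_div_atTop (R := ℝ)).comp hcoe)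
    simpa using this
  refine tendsto_of_tendsto_of_tendsto_of_le_of_le' hlow hup ?_ ?_
  · filter_upwards [eventually_ge_atTop 1] with t ht
    have ht' : (1 : ℝ) ≤ t := by exact_mod_cast ht
    have hf : (0 : ℝ) < (⌊(t : ℝ)⌋₊ : ℕ) := by exact_mod_cast Nat.floor_pos.2 ht'
    have hle : (⌊(t : ℝ)⌋₊ : ℝ≥0) ≤ t := by
      rw [← NNReal.coe_le_coe]
      simpa using Nat.floor_le t.coe_nonneg
    rw [div_mul_div_cancel₀ hf.ne', div_eq_inv_mul]
    have : (N (⌊(t : ℝ)⌋₊ : ℝ≥0) ω : ℝ) ≤ N t ω := by exact_mod_cast h2.1 hle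
    gcongr
  · filter_upwards [eventually_ge_atTop 1] with t ht
    have ht' : (0 : ℝ) < t := by exact_mod_cast one_pos.trans_le ht
    have hf : (0 : ℝ) < (⌈(t : ℝ)⌉₊ : ℕ) := by exact_mod_cast Nat.ceil_pos.2 ht'
    have hle : t ≤ (⌈(t : ℝ)⌉₊ : ℝ≥0) := by
      rw [← NNReal.coe_le_coe]
      simpa using Nat.le_ceil (t : ℝ)
    rw [div_mul_div_cancel₀ hf.ne', div_eq_inv_mul]
    have : (N t ω : ℝ) ≤ N (⌈(t : ℝ)⌉₊ : ℝ≥0) ω := by exact_mod_cast h2.1 hle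
    gcongr

variable [TopologicalSpace V] [CompactSpace V] [BorelSpace V]

lemma IsUserProcess.tendsto_average (h : IsUserProcess μ P N X) (φ : C(V, ℝ)) :
    ∀ᵐ ω ∂P, Tendsto (fun n : ℕ => (∑ i ∈ Finset.range n, φ (X i ω)) / n) atTop
      (𝓝 ((μ.mass : ℝ)⁻¹ * ∫ v, φ v ∂(μ : Measure V))) := by
  have hφ : Measurable φ := φ.continuous.measurable
  obtain ⟨M, hM⟩ := exists_abs_le_of_continuous φ.continuous
  have hmean : ∫ ω, φ (X 0 ω) ∂P = (μ.mass : ℝ)⁻¹ * ∫ v, φ v ∂(μ : Measure V) := by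
    rw [← integral_map (f := φ) (h.measurable_location 0).aemeasurable hφ.aestronglyMeasurable,
      h.location_law 0, integral_smul_measure, smul_eq_mul, ENNReal.toReal_inv,
      ← FiniteMeasure.ennreal_mass, ENNReal.coe_toReal]
  rw [← hmean]
  exact strong_law_ae_real (fun i ω => φ (X i ω))
    (integrable_of_abs_le (hφ.comp (h.measurable_location 0)) fun ω => hM _)
    (fun i j hij => (h.location_indep.indepFun hij).comp hφ hφ)
    (fun i => (IdentDistrib.mk (h.measurable_location i).aemeasurable
      (h.measurable_location 0).aemeasurable
      ((h.location_law i).trans (h.location_law 0).symm)).comp hφ)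

/-- Weak convergence of measures of bounded mass may be tested on a dense set of functions. -/
lemma tendsto_finiteMeasure_of_dense {ι : Type*} {l : Filter ι} {L : ι → FiniteMeasure V}
    (hmass : Tendsto (fun i => ((L i).mass : ℝ)) l (𝓝 (μ.mass : ℝ))) {D : Set C(V, ℝ)}
    (hD : Dense D) (h : ∀ φ ∈ D, Tendsto (fun i => ∫ v, φ v ∂(L i : Measure V)) l
      (𝓝 (∫ v, φ v ∂(μ : Measure V)))) : Tendsto L l (𝓝 μ) := by
  refine FiniteMeasure.tendsto_of_forall_integral_tendsto fun f => ?_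
  rw [Metric.tendsto_nhds]
  intro ε hε
  set M : ℝ := μ.mass + 1 with hMdef
  have hM : 0 < M := by positivity
  obtain ⟨φ, hφD, hφ⟩ := hD.exists_dist_lt f.toContinuousMap (ε := ε / (3 * M)) (by positivity)
  have hsub : ∀ ν : FiniteMeasure V, (ν.mass : ℝ) ≤ M →
      |∫ v, f v ∂(ν : Measure V) - ∫ v, φ v ∂(ν : Measure V)| ≤ ε / 3 := by
    intro ν hν
    rw [← integral_sub (integrable_of_continuous f.continuous)
      (integrable_of_continuous φ.continuous)]
    have hb : ∀ v, ‖f v - φ v‖ ≤ ε / (3 * M) := fun v => by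
      rw [← dist_eq_norm]
      exact (ContinuousMap.dist_apply_le_dist (f := f.toContinuousMap) (g := φ) v).trans hφ.le
    refine (norm_integral_le_of_norm_le_const (ae_of_all (ν : Measure V) hb)).trans ?_
    change ε / (3 * M) * (ν.mass : ℝ) ≤ ε / 3
    calc ε / (3 * M) * (ν.mass : ℝ) ≤ ε / (3 * M) * M := by gcongr
      _ = ε / 3 := by field_simp
  filter_upwards [(Metric.tendsto_nhds.1 (h φ hφD)) (ε / 3) (by positivity),
    hmass.eventually_lt_const (lt_add_one (μ.mass : ℝ))] with i h1 h2
  have h3 := hsub (L i) h2.le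
  have h4 := hsub μ (by rw [hMdef]; linarith)
  rw [Real.dist_eq] at h1 ⊢
  rw [abs_lt] at h1 ⊢
  rw [abs_le] at h3 h4
  constructor <;> linarith

variable [SecondCountableTopology V] [TopologicalSpace.MetrizableSpace V]

/-- The normalized empirical measures of the users converge weakly to `μ`, almost surely. -/
theorem IsUserProcess.tendsto_userEmpirical (h : IsUserProcess μ P N X) (hμ : μ.mass ≠ 0) :
    ∀ᵐ ω ∂P, Tendsto (fun lam : ℝ≥0 => userEmpirical lam (fun i : Fin (N lam ω) => X i ω)) atTop
      (𝓝 μ) := by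
  have hm : (0 : ℝ) < μ.mass := by exact_mod_cast pos_iff_ne_zero.2 hμ
  -- Separability of `C(V, ℝ)` reduces weak convergence to countably many strong laws, hence to a
  -- single null set.
  obtain ⟨D, hDc, hD⟩ := TopologicalSpace.exists_countable_dense C(V, ℝ)
  have hall := (ae_ball_iff hDc).2 fun φ (_ : φ ∈ D) => h.tendsto_average φ
  filter_upwards [hall, h.tendsto_count] with ω h1 h2
  have hN : Tendsto (fun lam => N lam ω) atTop atTop := by
    have h3 : Tendsto (fun lam : ℝ≥0 => (lam : ℝ) * ((lam : ℝ)⁻¹ * N lam ω)) atTop atTop :=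
      tendsto_coe_atTop.atTop_mul_pos hm h2
    refine tendsto_natCast_atTop_iff.1 (h3.congr' ?_)
    filter_upwards [eventually_gt_atTop 0] with lam hlam
    exact mul_inv_cancel_left₀ (NNReal.coe_ne_zero.2 hlam.ne') _
  refine tendsto_finiteMeasure_of_dense (by simpa only [mass_userEmpirical] using h2) hD ?_
  intro φ hφ
  have h4 := h2.mul ((h1 φ hφ).comp hN)
  rw [mul_inv_cancel_left₀ hm.ne'] at h4
  refine h4.congr' ?_
  filter_upwards [hN.eventually_gt_atTop 0] with lam hpos
  have : ((N lam ω : ℕ) : ℝ) ≠ 0 := by exact_mod_cast hpos.ne'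
  rw [integral_userEmpirical _ _ φ.continuous.measurable,
    Fin.sum_univ_eq_sum_range (fun i => φ (X i ω))]
  simp only [Function.comp_apply]
  field_simp

end Users

/-! ### Conclusions for the scaled penalties -/

section Conclusion

universe u

variable {V : Type u} [TopologicalSpace V] [CompactSpace V] [SecondCountableTopology V]
  [MeasurableSpace V] [BorelSpace V] [TopologicalSpace.MetrizableSpace V] {kmax : ℕ}
  {f : Penalty V kmax} {μ : FiniteMeasure V}

lemma limitPenalty_scale (γ : ℝ) (S : MeasureFamily V kmax) :
    limitPenalty (scale γ f) μ S = γ * limitPenalty f μ S := by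
  simp only [limitPenalty, scale, integral_const_mul, Finset.mul_sum]

lemma freeEnergy_eq_klSum (hk : 0 < kmax) (hf : ∀ k, Continuous (f k)) (hμ : μ.mass ≠ 0) (γ : ℝ)
    {S : MeasureFamily V kmax} (hS : IsRouteingStrategy μ S) :
    freeEnergy f γ μ S =
      (klSum (scale γ f) μ S : EReal) + ((-pressure (scale γ f) μ : ℝ) : EReal) := by
  rw [klSum_eq_freeEnergy hk (continuous_scale hf γ) hμ hS, freeEnergy, limitPenalty_scale,
    add_assoc, ← EReal.coe_add]
  congr 2
  ring

/-- For zero penalty each hop number contributes `1` to the site weight, which is therefore the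
constant `kmax`. The pressure `μ(V) log kmax` is the additive constant of the rate function. -/
lemma rateFunction_eq_gibbsRate (hk : 0 < kmax) (hf : ∀ k, Continuous (f k)) (hμ : μ.mass ≠ 0) :
    (rateFunction μ : MeasureFamily V kmax → EReal) = gibbsRate (scale 0 f) μ := by
  have hm : (0 : ℝ) < μ.mass := by exact_mod_cast pos_iff_ne_zero.2 hμ
  ext S
  by_cases hS : IsRouteingStrategy μ S
  · have hw : ∀ v, siteWeight (scale 0 f) μ v = kmax := by
      intro v
      have : ∀ k : Fin kmax, ((μ.mass : ℝ) ^ (k : ℕ))⁻¹ * (μ.mass : ℝ) ^ (k : ℕ) = 1 :=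
        fun k => inv_mul_cancel₀ (by positivity)
      have hreal : ((μ : Measure V) Set.univ).toReal = μ.mass := rfl
      simp [siteWeight, scale, Measure.real, Measure.pi_univ, hreal, this]
    have hp : pressure (scale 0 f) μ = μ.mass * Real.log kmax := by
      simp only [pressure, hw, integral_const, smul_eq_mul]
      rfl
    rw [rateFunction, gibbsRate, if_pos hS, if_pos hS,
      klSum_eq_freeEnergy hk (continuous_scale hf 0) hμ hS, limitPenalty_scale, zero_mul, zero_add,
      hp]
  · rw [rateFunction, gibbsRate, if_neg hS, if_neg hS]

lemma isMinimizer_optimal (hk : 0 < kmax) (hf : ∀ k, Continuous (f k)) (hμ : μ.mass ≠ 0) (γ : ℝ) :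
    IsMinimizer f γ μ (optimal (scale γ f) μ) := by
  have hO := isRouteingStrategy_optimal hk (continuous_scale hf γ) hμ
  refine ⟨hO, fun S' hS' => ?_⟩
  rw [freeEnergy_eq_klSum hk hf hμ γ hO, freeEnergy_eq_klSum hk hf hμ γ hS',
    klSum_optimal hk (continuous_scale hf γ) hμ]
  exact add_le_add_left (EReal.coe_ennreal_nonneg _) _

lemma IsMinimizer.eq_optimal (hk : 0 < kmax) (hf : ∀ k, Continuous (f k)) (hμ : μ.mass ≠ 0)
    {γ : ℝ} {S : MeasureFamily V kmax} (hS : IsMinimizer f γ μ S) : S = optimal (scale γ f) μ := by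
  have hO := isRouteingStrategy_optimal hk (continuous_scale hf γ) hμ
  refine eq_optimal_of_klSum_eq_zero hk (continuous_scale hf γ) hμ ?_
  have h := hS.2 _ hO
  rw [freeEnergy_eq_klSum hk hf hμ γ hO, freeEnergy_eq_klSum hk hf hμ γ hS.1,
    klSum_optimal hk (continuous_scale hf γ) hμ, EReal.coe_ennreal_zero, zero_add] at h
  by_contra hne
  have hpos : (0 : EReal) < (klSum (scale γ f) μ S : EReal) := by
    rw [EReal.coe_ennreal_pos]
    exact pos_iff_ne_zero.2 hne
  have h2 := EReal.add_lt_add_right_coe hpos (-pressure (scale γ f) μ)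
  rw [zero_add] at h2
  exact absurd h (not_le.2 h2)

lemma iInf_freeEnergy (hk : 0 < kmax) (hf : ∀ k, Continuous (f k)) (hμ : μ.mass ≠ 0) (γ : ℝ) :
    -(⨅ (S : MeasureFamily V kmax) (_ : IsRouteingStrategy μ S), freeEnergy f γ μ S) =
      ((pressure (scale γ f) μ : ℝ) : EReal) := by
  have hO := isMinimizer_optimal hk hf hμ γ
  have : ⨅ (S : MeasureFamily V kmax) (_ : IsRouteingStrategy μ S), freeEnergy f γ μ S =
      freeEnergy f γ μ (optimal (scale γ f) μ) :=
    le_antisymm (iInf₂_le _ hO.1) (le_iInf₂ hO.2)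
  rw [this, freeEnergy_eq_klSum hk hf hμ γ hO.1, klSum_optimal hk (continuous_scale hf γ) hμ,
    EReal.coe_ennreal_zero, zero_add, EReal.coe_neg, neg_neg]

end Conclusion

end MultihopGibbs

end

/-! ### Specialization to `g = 0 · f` and `g = γ f`. -/

theorem proposition1p5 {d : ℕ} (hd : 0 < d)
    (W : Set (EuclideanSpace ℝ (Fin d))) (hW : IsCompact W) (hoW : (0 : EuclideanSpace ℝ (Fin d)) ∈ W)
    (μ : FiniteMeasure W) (hμ_ac : (μ : Measure W).map Subtype.val ≪ volume) (hμ_pos : 0 < μ.mass)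
    {kmax : ℕ} (hk : 0 < kmax)
    (f : MultihopGibbs.Penalty W kmax) (hf_cont : ∀ k, Continuous (f k))
    (hf_bdd : ∀ k, ∃ c : ℝ, ∀ p, c ≤ f k p)
    {Ω : Type*} [MeasurableSpace Ω] (P : Measure Ω) [IsProbabilityMeasure P]
    (N : ℝ≥0 → Ω → ℕ) (X : ℕ → Ω → W) (hNX : MultihopGibbs.IsUserProcess μ P N X) :
    -- the large deviation principle, the free energy and the convergence, almost surely
    (∀ᵐ ω ∂P,
      MultihopGibbs.IsLDP
        (fun lam E => MultihopGibbs.gibbsProb f 0 lam (fun i : Fin (N lam ω) => X i ω) E)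
        (MultihopGibbs.rateFunction (kmax := kmax) μ) ∧
      (∀ γ : ℝ, 0 < γ →
        Tendsto (fun lam : ℝ≥0 => (((lam : ℝ)⁻¹ * Real.log
            (MultihopGibbs.partitionFunction f γ lam (fun i : Fin (N lam ω) => X i ω)) : ℝ) : EReal))
          atTop
          (𝓝 (-(⨅ (S : MultihopGibbs.MeasureFamily W kmax)
            (_ : MultihopGibbs.IsRouteingStrategy μ S), MultihopGibbs.freeEnergy f γ μ S)))) ∧
      (∀ γ : ℝ, 0 < γ → ∀ S : MultihopGibbs.MeasureFamily W kmax,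
        MultihopGibbs.IsMinimizer f γ μ S → ∀ U ∈ 𝓝 S,
          Tendsto (fun lam : ℝ≥0 =>
              MultihopGibbs.gibbsProb f γ lam (fun i : Fin (N lam ω) => X i ω) Uᶜ)
            atTop (𝓝 0))) ∧
    -- compactness of the level sets of the rate function
    (∀ α : ℝ, IsCompact {S : MultihopGibbs.MeasureFamily W kmax |
      MultihopGibbs.rateFunction μ S ≤ (α : EReal)}) ∧
    -- existence, uniqueness and explicit form of the minimizer
    (∀ γ : ℝ, 0 < γ → ∃ S : MultihopGibbs.MeasureFamily W kmax,
      MultihopGibbs.IsMinimizer f γ μ S ∧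
      (∀ S' : MultihopGibbs.MeasureFamily W kmax, MultihopGibbs.IsMinimizer f γ μ S' → S' = S) ∧
      ∀ k : Fin kmax, (S k : Measure (Fin ((k : ℕ) + 1) → W)) =
        MultihopGibbs.explicitMeasure f γ μ k) := by
  have : CompactSpace W := isCompact_iff_compactSpace.1 hW
  have hμ : μ.mass ≠ 0 := hμ_pos.ne'
  refine ⟨?_, fun α => ?_, fun γ _ => ?_⟩
  -- The exceptional null set is that of the weak convergence of `L_λ`, so one almost sure event
  -- serves all `γ` at once.
  · filter_upwards [hNX.tendsto_userEmpirical hμ] with ω hω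
    refine ⟨?_, fun γ _ => ?_, fun γ _ S hS U hU => ?_⟩
    · simp only [MultihopGibbs.gibbsProb_scale f 0]
      rw [MultihopGibbs.rateFunction_eq_gibbsRate hk hf_cont hμ]
      exact MultihopGibbs.isLDP_gibbsRate hk (MultihopGibbs.continuous_scale hf_cont 0) hμ hω
    · rw [MultihopGibbs.iInf_freeEnergy hk hf_cont hμ γ]
      simp only [MultihopGibbs.partitionFunction_scale f γ]
      exact (continuous_coe_real_ereal.tendsto _).comp
        (MultihopGibbs.tendsto_log_partitionFunction hk
          (MultihopGibbs.continuous_scale hf_cont γ) hμ hω)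
    · simp only [MultihopGibbs.gibbsProb_scale f γ]
      rw [hS.eq_optimal hk hf_cont hμ] at hU
      exact MultihopGibbs.tendsto_gibbsProb_compl hk
        (MultihopGibbs.continuous_scale hf_cont γ) hμ hω hU
  · rw [MultihopGibbs.rateFunction_eq_gibbsRate hk hf_cont hμ]
    exact MultihopGibbs.isCompact_gibbsRate_le hk (MultihopGibbs.continuous_scale hf_cont 0) hμ α
  · refine ⟨MultihopGibbs.optimal (MultihopGibbs.scale γ f) μ,
      MultihopGibbs.isMinimizer_optimal hk hf_cont hμ γ,
      fun S' hS' => hS'.eq_optimal hk hf_cont hμ, fun k => ?_⟩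
    rw [MultihopGibbs.explicitMeasure_eq_optimalMeasure hk hf_cont γ hμ,
      MultihopGibbs.coe_optimal hk (MultihopGibbs.continuous_scale hf_cont γ) hμ]
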